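/- Let $I\subset\mathbb R$ be open, $F\colon I\to\mathbb R$ smooth with $F''\neq0$ on $I$, and let $J=\{(x,y,p,q,z)\in\mathbb R^5: q\in I\}$. Derivatives of $F$ are evaluated at $q$, and $(F'')^{k/3}$ is the $k$-th power of the real cube root of $F''$. Products of 1-forms in metrics are symmetric products. Put $$P=\frac{4F^{(3)2}-3F''F^{(4)}}{90(F'')^{10/3}},\qquad Q=\frac{40F^{(3)3}-45F''F^{(3)}F^{(4)}+9F''^2F^{(5)}}{90F''^5},$$ $$A_5=\frac{-224F^{(3)4}+336F''F^{(3)2}F^{(4)}-51F''^2F^{(4)2}-80F''^2F^{(3)}F^{(5)}+10F''^3F^{(6)}}{100(F'')^{20/3}},$$ and on $J$ define $$\theta^1=dy-p\,dx,\quad \theta^2=dz-F\,dx-F'(dp-q\,dx),\quad \theta^3=-\tfrac{2}{\sqrt3}(F'')^{1/3}(dp-q\,dx),\quad \theta^5=-(F'')^{2/3}dq,$$ $$30(F'')^{10/3}\theta^4=\big(3F'F''F^{(4)}-4F'F^{(3)2}-10F''^2F^{(3)}\big)(dp-q\,dx)+\big(4F^{(3)2}-3F''F^{(4)}\big)(dz-F\,dx)+30F''^3dx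 .$$ Let $g_F$ be the metric on $J$ given by $$\begin{aligned}-15(F'')^{10/3}g_F={}&30F''^4(dq\,dy-p\,dq\,dx)+(4F^{(3)2}-3F''F^{(4)})dz^2+2(-5F''^2F^{(3)}-4F'F^{(3)2}+3F'F''F^{(4)})dp\,dz\\&+2(15F''^3+5qF''^2F^{(3)}-4FF^{(3)2}+4qF'F^{(3)2}+3FF''F^{(4)}-3qF'F''F^{(4)})dx\,dz\\&+(-20F''^4+10F'F''^2F^{(3)}+4F'^2F^{(3)2}-3F'^2F''F^{(4)})dp^2\\&+2(-15F'F''^3+20qF''^4+5FF''^2F^{(3)}-10qF'F''^2F^{(3)}+4FF'F^{(3)2}-4qF'^2F^{(3)2}-3FF'F''F^{(4)}+3qF'^2F''F^{(4)})dp\,dx\\&+(-30FF''^3+30qF'F''^3-20q^2F''^4-10qFF''^2F^{(3)}+10q^2F'F''^2F^{(3)}+4F^2F^{(3)2}-8qFF'F^{(3)2}\\&\qquad+4q^2F'^2F^{(3)2}-3F^2F''F^{(4)}+6qFF'F''F^{(4)}-3q^2F'^2F''F^{(4)})dx^2 .\end{aligned}$$ On $M=J\times\mathbb R_+\times\mathbb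 R$, with coordinates $t>0$, $u$ on the last two factors and $\pi\colon M\to J$ the projection, write $\theta^\mu$ also for $\pi^*\theta^\mu$, and put $\theta^0=dt$, $\theta^6=du$ and $\Sigma=\{t=1,\ u=0\}$, which $\pi$ identifies with $J$. Let $$\tilde g_F=t^2g_F-2\,dt\,du-2tu(F'')^{4/3}P\,dq^2 .$$ Then the following hold. 1. Nurowski's general formula for a representative of the conformal class attached to an equation $z'=F(x,y,y',y'',z)$ with $F_{y''y''}\ne0$ gives, for the equation $z'=F(y'')$, the form $-15(F'')^{10/3}g_F$. So $g_F$ represents the class $[g_F]$ of $z'=F(y'')$. The forms $\theta^1,\dots,\theta^5$ are a coframe on $J$, and $g_F=2\theta^1\theta^5-2\theta^2\theta^4+(\theta^3)^2$. 2. $\tilde g_F$ is a Fefferman–Graham ambient metric of $g_F$: it is Ricci flat and of the form $-2\,dt\,du+t^2g_F+\sum_{k\ge1}u^kt^{2-k}\mu_k$ with symmetric bilinear forms $\mu_k$ on $J$. 3. A matrix of 1-forms on $J$ is the Cartan normal conformal connection of $[g_F]$ in the coframe $(\theta^\mu)$ if and only if it equals $$\omega_{G_2}=\begin{pmatrix}0&0&0&0&0&-P\theta^5&0\\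 \theta^1&0&\psi&\frac1{\sqrt3}\theta^4&-\frac1{2\sqrt3}\theta^3&0&-P\theta^5\\ \theta^2&0&0&\frac1{\sqrt3}\theta^5&0&-\frac1{2\sqrt3}\theta^3&0\\ \theta^3&0&-2\sqrt3P\theta^5&0&\frac1{\sqrt3}\theta^5&-\frac1{\sqrt3}\theta^4&0\\ \theta^4&0&0&-2\sqrt3P\theta^5&0&\psi&0\\ \theta^5&0&0&0&0&0&0\\ 0&\theta^5&-\theta^4&\theta^3&-\theta^2&\theta^1&0\end{pmatrix},\qquad \psi=Q\theta^2+\tfrac{9}{2\sqrt3}P\theta^3 .$$ Here the normal conformal connection in $(\theta^\mu)$ is the smooth $\mathfrak{so}(4,3)$-valued 1-form $\omega=(\omega^a{}_b)_{0\le a,b\le6}$ (for the quadratic form $-2X^0X^6+2X^1X^5-2X^2X^4+(X^3)^2$) with $\omega^\mu{}_0=\theta^\mu$ and $\omega^0{}_0=0$ whose curvature $\Omega=d\omega+\omega\wedge\omega$ satisfies $\Omega^\mu{}_0=0$ and $\sum_\mu\Omega^\mu{}_\nu(e_\mu,\cdot)=0$ for $1\le\mu,\nu\le5$, where $(e_\mu)$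 is the frame dual to $(\theta^\mu)$. 4. $\theta^0,\dots,\theta^6$ are a coframe on $M$, and $\tilde g_F=\sum_{i,j=0}^6g_{ij}\theta^i\theta^j$ with nonzero entries only $g_{06}=g_{60}=-1$, $g_{15}=g_{51}=t^2$, $g_{24}=g_{42}=-t^2$, $g_{33}=t^2$, $g_{55}=-2tuP$. In this coframe a matrix of 1-forms $\omega$ on $M$ is the Levi-Civita connection of $\tilde g_F$ (that is, $d\theta^i+\omega^i{}_j\wedge\theta^j=0$ and $dg_{ij}=g_{ik}\omega^k{}_j+g_{jk}\omega^k{}_i$) if and only if it equals $$\omega_{LC}=\begin{pmatrix}0&0&0&0&0&-tP\theta^5&0\\ \frac1t\theta^1+\frac u{t^2}P\theta^5&\frac1t\theta^0&\psi&\frac1{\sqrt3}\theta^4&-\frac1{2\sqrt3}\theta^3&\frac u{t^2}P\theta^0-\frac u{3t}Q\theta^5-\frac1tP\theta^6&-\frac1tP\theta^5\\ \frac1t\theta^2&0&\frac1t\theta^0&\frac1{\sqrt3}\theta^5&0&-\frac1{2\sqrt3}\theta^3&0\\ \frac1t\theta^3&0&-2\sqrt3P\theta^5&\frac1t\theta^0&\frac1{\sqrt3}\theta^5&-\frac1{\sqrt3}\theta^4&0\\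 \frac1t\theta^4&0&0&-2\sqrt3P\theta^5&\frac1t\theta^0&\psi&0\\ \frac1t\theta^5&0&0&0&0&\frac1t\theta^0&0\\ 0&t\theta^5&-t\theta^4&t\theta^3&-t\theta^2&t\theta^1-uP\theta^5&0\end{pmatrix}.$$ 5. The pullback of $\omega_{LC}$ to $\Sigma\cong J$ is $\omega_{G_2}$. 6. On $M$, the torsion of $\pi^*\omega_{G_2}$ is $$d\theta^i+(\pi^*\omega_{G_2})^i{}_j\wedge\theta^j=\begin{pmatrix}0\\-\theta^0\wedge\theta^1-P\theta^5\wedge\theta^6\\-\theta^0\wedge\theta^2\\-\theta^0\wedge\theta^3\\-\theta^0\wedge\theta^4\\-\theta^0\wedge\theta^5\\0\end{pmatrix}.$$ Its components $i=1,\dots,5$ are nonzero at every point of $M$ (in particular off $\Sigma$), while its pullback to $\Sigma$ vanishes. 7. The curvature $d\omega_{LC}+\omega_{LC}\wedge\omega_{LC}$ does not depend on $t$ and $u$, is annihilated by $\partial_t$ and $\partial_u$, and equals the pullback by $\pi$ of $d\omega_{G_2}+\omega_{G_2}\wedge\omega_{G_2}$. Both curvatures are $A_5\,E\,\theta^2\wedge\theta^5$,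 where $E$ is the constant $7\times7$ matrix, with rows and columns numbered $0,\dots,6$, whose entries are $1$ in the positions $(1,2)$ and $(4,5)$ and $0$ elsewhere. -/

import Mathlib

noncomputable section

namespace G2Ambient

/-! ### Differential forms, connections and curvature on open subsets of normed spaces -/

section General

variable {E E' : Type*} [NormedAddCommGroup E] [NormedSpace ℝ E]
  [NormedAddCommGroup E'] [NormedSpace ℝ E'] {ι : Type*} [Fintype ι] [DecidableEq ι]

/-- The exterior derivative of a 1-form: Mathlib's `extDeriv`, after the identification of
1-forms `E → (E →L[ℝ] ℝ)` with alternating forms of degree one. -/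
def d1 (α : E → E →L[ℝ] ℝ) (x : E) : E [⋀^Fin 2]→L[ℝ] ℝ :=
  extDeriv (fun y => ContinuousAlternatingMap.ofSubsingleton ℝ E ℝ (0 : Fin 1) (α y)) x

/-- The wedge product of two covectors, `(α ∧ β)(v, w) = α v * β w - α w * β v`. -/
def wedge (α β : E →L[ℝ] ℝ) : E [⋀^Fin 2]→L[ℝ] ℝ :=
  ContinuousAlternatingMap.alternatizeUncurryFin
    (α.smulRight (ContinuousAlternatingMap.ofSubsingleton ℝ E ℝ (0 : Fin 1) β))

theorem wedge_apply (α β : E →L[ℝ] ℝ) (v w : E) :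
    wedge α β ![v, w] = α v * β w - α w * β v := by
  simp [wedge, ContinuousAlternatingMap.alternatizeUncurryFin_apply, Fin.sum_univ_two,
    Fin.removeNth, sub_eq_add_neg]

theorem d1_apply {α : E → E →L[ℝ] ℝ} {x : E} (hα : DifferentiableAt ℝ α x) (v w : E) :
    d1 α x ![v, w] = fderiv ℝ α x v w - fderiv ℝ α x w v := by
  have h : DifferentiableAt ℝ
      (fun y => ContinuousAlternatingMap.ofSubsingleton ℝ E ℝ (0 : Fin 1) (α y)) x :=
    (ContinuousAlternatingMap.ofSubsingletonLIE (𝕜 := ℝ) (E := E) (F := ℝ)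
      (0 : Fin 1)).differentiable.differentiableAt.comp x hα
  have h1 : ∀ a b : E, fderiv ℝ (fun y => α y a) x b = fderiv ℝ α x b a := fun a b => by
    rw [fderiv_clm_apply hα (differentiableAt_const a)]
    simp
  rw [d1, extDeriv_apply h]
  simp [Fin.sum_univ_two, Fin.removeNth, h1, sub_eq_add_neg]

/-- The symmetric product of covectors, `αβ = (α ⊗ β + β ⊗ α) / 2`, as a bilinear form. -/
def symProd (α β : E →L[ℝ] ℝ) : E →L[ℝ] E →L[ℝ] ℝ :=
  (1 / 2 : ℝ) • (α.smulRight β + β.smulRight α)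

infixl:75 " ⊙ₛ " => symProd

/-- The pullback of a 1-form along a map. -/
def pullback (f : E → E') (α : E' → E' →L[ℝ] ℝ) (x : E) : E →L[ℝ] ℝ :=
  (α (f x)).comp (fderiv ℝ f x)

/-- The entrywise pullback of a matrix of 1-forms. -/
def pullbackMatrix (f : E → E') (ω : E' → Matrix ι ι (E' →L[ℝ] ℝ)) (x : E) :
    Matrix ι ι (E →L[ℝ] ℝ) :=
  Matrix.of fun i j => pullback f (fun y => ω y i j) x

/-- The pullback of a 2-form along a map. -/
def pullback2 (f : E → E') (Ω : E' → E' [⋀^Fin 2]→L[ℝ] ℝ) (x : E) : E [⋀^Fin 2]→L[ℝ] ℝ :=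
  (Ω (f x)).compContinuousLinearMap (fderiv ℝ f x)

/-- The curvature `dω + ω ∧ ω` of a matrix of 1-forms. -/
def curvature (ω : E → Matrix ι ι (E →L[ℝ] ℝ)) (x : E) :
    Matrix ι ι (E [⋀^Fin 2]→L[ℝ] ℝ) :=
  Matrix.of fun i j => d1 (fun y => ω y i j) x + ∑ k, wedge (ω x i k) (ω x k j)

/-- The torsion `dθ + ω ∧ θ` of a matrix of 1-forms `ω` with respect to `θ`. -/
def torsion (θ : E → ι → E →L[ℝ] ℝ) (ω : E → Matrix ι ι (E →L[ℝ] ℝ)) (x : E) (i : ι) :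
    E [⋀^Fin 2]→L[ℝ] ℝ :=
  d1 (fun y => θ y i) x + ∑ j, wedge (ω x i j) (θ x j)

/-- A smooth coframe on `U`. -/
def IsCoframeOn (U : Set E) (θ : E → ι → E →L[ℝ] ℝ) : Prop :=
  (∀ i, ContDiffOn ℝ (⊤ : ℕ∞) (fun x => θ x i) U) ∧
    ∀ x ∈ U, LinearIndependent ℝ (θ x) ∧ Submodule.span ℝ (Set.range (θ x)) = ⊤

/-- `e` is the frame dual to the coframe `θ` (at one point). -/
def IsDualFrame (θ : ι → E →L[ℝ] ℝ) (e : ι → E) : Prop :=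
  ∀ i j, θ i (e j) = if i = j then 1 else 0

/-- In the coframe `θ`, in which the (pseudo-Riemannian) metric is `g = G_ij θ^i θ^j`, the matrix
`ω` of 1-forms is that of the Levi-Civita connection of `g`: it is torsion free,
`dθ^i + ω^i_j ∧ θ^j = 0`, and metric, `dG_ij = G_ik ω^k_j + G_jk ω^k_i`. -/
structure IsLeviCivitaOn (U : Set E) (g : E → E →L[ℝ] E →L[ℝ] ℝ) (θ : E → ι → E →L[ℝ] ℝ)
    (G : E → Matrix ι ι ℝ) (ω : E → Matrix ι ι (E →L[ℝ] ℝ)) : Prop where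
  coframe : IsCoframeOn U θ
  metric_eq : ∀ x ∈ U, g x = ∑ i, ∑ j, G x i j • θ x i ⊙ₛ θ x j
  symm : ∀ x ∈ U, (G x).IsSymm
  nondegenerate : ∀ x ∈ U, (G x).det ≠ 0
  torsion_eq_zero : ∀ x ∈ U, ∀ i, torsion θ ω x i = 0
  compatible : ∀ x ∈ U, ∀ i j, HasFDerivAt (fun y => G y i j)
    (∑ k, (G x i k • ω x k j + G x j k • ω x k i)) x

/-- The Ricci contraction `Ω^i_j(e_i, ·)` of the curvature of `ω` vanishes on `U`, where `(e_i)` is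
the frame dual to `θ`. -/
def RicciContractionVanishesOn (U : Set E) (θ : E → ι → E →L[ℝ] ℝ)
    (ω : E → Matrix ι ι (E →L[ℝ] ℝ)) : Prop :=
  ∀ x ∈ U, ∀ e : ι → E, IsDualFrame (θ x) e → ∀ j v, ∑ i, curvature ω x i j ![e i, v] = 0

/-- `h` is conformal to `g` on `U`: it is a smooth nowhere vanishing multiple of `g`. -/
def IsConformalOn (U : Set E) (g h : E → E →L[ℝ] E →L[ℝ] ℝ) : Prop :=
  ∃ φ : E → ℝ, ContDiffOn ℝ (⊤ : ℕ∞) φ U ∧ ∀ x ∈ U, φ x ≠ 0 ∧ h x = φ x • g x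

end General

/-! ### The normal conformal connection in dimension five -/

/-- The matrix of the quadratic form `2θ¹θ⁵ - 2θ²θ⁴ + (θ³)²`. -/
def eta : Matrix (Fin 5) (Fin 5) ℝ :=
  !![0, 0, 0, 0, 1;
     0, 0, 0, -1, 0;
     0, 0, 1, 0, 0;
     0, -1, 0, 0, 0;
     1, 0, 0, 0, 0]

/-- The quadratic form of signature `(4, 3)` on `ℝ ⊕ ℝ⁵ ⊕ ℝ` made of `eta` and of the hyperbolic
plane `-2 X⁰ X⁶`. -/
def tractorForm : Matrix (Fin 7) (Fin 7) ℝ :=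
  !![0, 0, 0, 0, 0, 0, -1;
     0, 0, 0, 0, 0, 1, 0;
     0, 0, 0, 0, -1, 0, 0;
     0, 0, 0, 1, 0, 0, 0;
     0, 0, -1, 0, 0, 0, 0;
     0, 1, 0, 0, 0, 0, 0;
     -1, 0, 0, 0, 0, 0, 0]

/-- The inclusion `{1, …, 5} ⊆ {0, …, 6}`; the element `μ` of `Fin 5` stands for the index
`μ + 1`. -/
def mid (μ : Fin 5) : Fin 7 := μ.succ.castSucc

/-- `ω` is the Cartan normal conformal connection of the conformal class of `g` on `U`, written in
the coframe `θ` (that is, pulled back by the section of the Cartan bundle determined by `θ`).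
The coframe is adapted to the class: `2θ¹θ⁵ - 2θ²θ⁴ + (θ³)²` is a metric in it. The connection takes
values in `so(4, 3)`, the Lie algebra of `tractorForm`; its soldering form is `θ`; the component
`ω⁰₀` vanishes (choice of the gauge); and it is normal: the torsion part `Ω^μ_0` of its curvature
`Ω = dω + ω ∧ ω` vanishes, as does the contraction `Ω^μ_ν(e_μ, ·)` with the dual frame. -/
structure IsNormalConformalConnectionOn {E : Type*} [NormedAddCommGroup E] [NormedSpace ℝ E]
    (U : Set E) (g : E → E →L[ℝ] E →L[ℝ] ℝ) (θ : E → Fin 5 → E →L[ℝ] ℝ)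
    (ω : E → Matrix (Fin 7) (Fin 7) (E →L[ℝ] ℝ)) : Prop where
  coframe : IsCoframeOn U θ
  adapted : IsConformalOn U g (fun x => ∑ μ, ∑ ν, eta μ ν • θ x μ ⊙ₛ θ x ν)
  smooth : ∀ a b, ContDiffOn ℝ (⊤ : ℕ∞) (fun x => ω x a b) U
  so_valued : ∀ x ∈ U, ∀ a b,
    ∑ c, (tractorForm a c • ω x c b + tractorForm b c • ω x c a) = 0
  soldering : ∀ x ∈ U, ∀ μ, ω x (mid μ) 0 = θ x μ
  gauge : ∀ x ∈ U, ω x 0 0 = 0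
  torsion_free : ∀ x ∈ U, ∀ μ, curvature ω x (mid μ) 0 = 0
  normal : ∀ x ∈ U, ∀ e : Fin 5 → E, IsDualFrame (θ x) e → ∀ ν v,
    ∑ μ, curvature ω x (mid μ) (mid ν) ![e μ, v] = 0

/-! ### Ambient metrics -/

/-- The space of the variables `(x, y, p, q, z)`, in this order. -/
abbrev Jet : Type := Fin 5 → ℝ

/-- The ambient space, with points `((x, y, p, q, z), t, u)`. -/
abbrev Amb : Type := Jet × ℝ × ℝ

/-- The projection of the ambient space onto the space of jets. -/
def proj (X : Amb) : Jet := X.1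

/-- The embedding of the space of jets onto the hypersurface `Σ = {t = 1, u = 0}`. -/
def sigma (v : Jet) : Amb := (v, 1, 0)

/-- The 1-form `dt`. -/
def dt : Amb →L[ℝ] ℝ := (ContinuousLinearMap.fst ℝ ℝ ℝ).comp (ContinuousLinearMap.snd ℝ Jet (ℝ × ℝ))

/-- The 1-form `du`. -/
def du : Amb →L[ℝ] ℝ := (ContinuousLinearMap.snd ℝ ℝ ℝ).comp (ContinuousLinearMap.snd ℝ Jet (ℝ × ℝ))

/-- The pullback of a bilinear form on the space of jets to the ambient space. -/
def liftForm (b : Jet →L[ℝ] Jet →L[ℝ] ℝ) : Amb →L[ℝ] Amb →L[ℝ] ℝ :=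
  b.bilinearComp (ContinuousLinearMap.fst ℝ Jet (ℝ × ℝ)) (ContinuousLinearMap.fst ℝ Jet (ℝ × ℝ))

/-- `gA` is Ricci flat on `U`: the Ricci contraction of the curvature of its Levi-Civita connection
vanishes. (The Ricci tensor is a tensor, so it does not matter in which coframe it is computed.) -/
def IsRicciFlatOn (U : Set Amb) (gA : Amb → Amb →L[ℝ] Amb →L[ℝ] ℝ) : Prop :=
  ∃ (θ : Amb → Fin 7 → Amb →L[ℝ] ℝ) (G : Amb → Matrix (Fin 7) (Fin 7) ℝ)
    (ω : Amb → Matrix (Fin 7) (Fin 7) (Amb →L[ℝ] ℝ)),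
    (∀ i j, ContDiffOn ℝ (⊤ : ℕ∞) (fun X => ω X i j) U) ∧
      IsLeviCivitaOn U gA θ G ω ∧ RicciContractionVanishesOn U θ ω

/-- `gA` is a (convergent) Fefferman-Graham ambient metric, on the neighbourhood `U` of `{u = 0}`
in `J × ℝ₊ × ℝ`, of the metric `g` on `J`: it is Ricci flat, and of the form
`-2 dt du + t² g + ∑_{k ≥ 1} u^k t^(2 - k) μ_k` with symmetric bilinear forms `μ_k` on `J`. -/
structure IsAmbientMetricOn (J : Set Jet) (U : Set Amb) (g : Jet → Jet →L[ℝ] Jet →L[ℝ] ℝ)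
    (gA : Amb → Amb →L[ℝ] Amb →L[ℝ] ℝ) : Prop where
  isOpen : IsOpen U
  subset : ∀ X ∈ U, proj X ∈ J ∧ 0 < X.2.1
  initial : ∀ v ∈ J, ∀ t : ℝ, 0 < t → (v, t, 0) ∈ U
  expansion : ∃ μ : ℕ → Jet → Jet →L[ℝ] Jet →L[ℝ] ℝ,
    (∀ k, ContDiffOn ℝ (⊤ : ℕ∞) (μ k) J) ∧ (∀ k, ∀ v ∈ J, ∀ a b, μ k v a b = μ k v b a) ∧
    ∀ X ∈ U, HasSum
      (fun k : ℕ => (X.2.2 ^ (k + 1) * X.2.1 ^ (2 - ((k : ℤ) + 1))) • liftForm (μ k (proj X)))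
      (gA X - ((-2 : ℝ) • dt ⊙ₛ du + X.2.1 ^ 2 • liftForm (g (proj X))))
  ricciFlat : IsRicciFlatOn U gA

/-! ### The conformal class of the equation `z' = F(x, y, y', y'', z)` -/

/-- The 1-form `dx`. -/
def dx : Jet →L[ℝ] ℝ := ContinuousLinearMap.proj 0
/-- The 1-form `dy`. -/
def dy : Jet →L[ℝ] ℝ := ContinuousLinearMap.proj 1
/-- The 1-form `dp`. -/
def dp : Jet →L[ℝ] ℝ := ContinuousLinearMap.proj 2
/-- The 1-form `dq`. -/
def dq : Jet →L[ℝ] ℝ := ContinuousLinearMap.proj 3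
/-- The 1-form `dz`. -/
def dz : Jet →L[ℝ] ℝ := ContinuousLinearMap.proj 4

/-- The partial derivative in the `i`-th of the variables `(x, y, p, q, z)`. -/
def pd (i : Fin 5) (f : Jet → ℝ) (v : Jet) : ℝ := lineDeriv ℝ f v (Pi.single i 1)

/-- The total differential `∂_x + p ∂_y + q ∂_p + F ∂_z` of the equation given by `F`. -/
def totalD (F f : Jet → ℝ) (v : Jet) : ℝ :=
  pd 0 f v + v 2 * pd 1 f v + v 3 * pd 2 f v + F v * pd 4 f v

/-- The representative, by the general formula, of the conformal class on the space of the variables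
`(x, y, p, q, z)` that is attached to the equation `z' = F(x, y, y', y'', z)`. -/
def equationMetric (F : Jet → ℝ) (v : Jet) : Jet →L[ℝ] Jet →L[ℝ] ℝ :=
  let D := totalD F
  let Fy := pd 1 F v
  let Fp := pd 2 F v
  let Fq := pd 3 F v
  let Fz := pd 4 F v
  let Fpp := pd 2 (pd 2 F) v
  let Fpz := pd 4 (pd 2 F) v
  let Fqp := pd 2 (pd 3 F) v
  let Fqq := pd 3 (pd 3 F) v
  let Fqy := pd 1 (pd 3 F) v
  let Fqz := pd 4 (pd 3 F) v
  let Fzz := pd 4 (pd 4 F) v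
  let Fqqp := pd 2 (pd 3 (pd 3 F)) v
  let Fqqq := pd 3 (pd 3 (pd 3 F)) v
  let Fqqz := pd 4 (pd 3 (pd 3 F)) v
  let Fqqqq := pd 3 (pd 3 (pd 3 (pd 3 F))) v
  let DFp := D (pd 2 F) v
  let DFq := D (pd 3 F) v
  let DFz := D (pd 4 F) v
  let DFqp := D (pd 2 (pd 3 F)) v
  let DFqq := D (pd 3 (pd 3 F)) v
  let DFqz := D (pd 4 (pd 3 F)) v
  let DFqqq := D (pd 3 (pd 3 (pd 3 F))) v
  let DDFq := D (D (pd 3 F)) v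
  let DDFqq := D (D (pd 3 (pd 3 F))) v
  let o1 := dy - v 2 • dx
  let o2 := dz - F v • dx - Fq • (dp - v 3 • dx)
  let o3 := dp - v 3 • dx
  let o4 := dq
  let o5 := dx
  (DFqq ^ 2 * Fqq ^ 2 + 6 * DFq * DFqqq * Fqq ^ 2 - 6 * DFqqq * Fp * Fqq ^ 2
      - 3 * DDFqq * Fqq ^ 3 + 9 * DFqp * Fqq ^ 3 - 9 * Fpp * Fqq ^ 3 + 9 * DFqz * Fq * Fqq ^ 3
      - 18 * Fpz * Fq * Fqq ^ 3 + 3 * DFz * Fqq ^ 4 - 6 * DFq * Fqq ^ 2 * Fqqp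
      + 6 * Fp * Fqq ^ 2 * Fqqp - 8 * DFq * DFqq * Fqq * Fqqq + 8 * DFqq * Fp * Fqq * Fqqq
      + 3 * DDFq * Fqq ^ 2 * Fqqq - 3 * DFp * Fqq ^ 2 * Fqqq - 3 * DFz * Fq * Fqq ^ 2 * Fqqq
      + 4 * DFq ^ 2 * Fqqq ^ 2 - 8 * DFq * Fp * Fqqq ^ 2 - 3 * DFq ^ 2 * Fqq * Fqqqq
      + 4 * Fp ^ 2 * Fqqq ^ 2 + 6 * DFq * Fp * Fqq * Fqqqq - 3 * Fp ^ 2 * Fqq * Fqqqq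
      - 6 * DFq * Fq * Fqq ^ 2 * Fqqz + 6 * Fp * Fq * Fqq ^ 2 * Fqqz - 3 * DFq * Fqq ^ 3 * Fqz
      + 12 * Fp * Fqq ^ 3 * Fqz + 3 * Fqq ^ 2 * Fqqq * Fy - 6 * DFqqq * Fq * Fqq ^ 2 * Fz
      + 4 * DFqq * Fqq ^ 3 * Fz + 6 * Fq * Fqq ^ 2 * Fqqp * Fz + 8 * DFqq * Fq * Fqq * Fqqq * Fz
      - 4 * DFq * Fqq ^ 2 * Fqqq * Fz - 9 * Fqp * Fqq ^ 3 * Fz + Fp * Fqq ^ 2 * Fqqq * Fz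
      - 8 * DFq * Fq * Fqqq ^ 2 * Fz + 8 * Fp * Fq * Fqqq ^ 2 * Fz
      + 6 * DFq * Fq * Fqq * Fqqqq * Fz - 6 * Fp * Fq * Fqq * Fqqqq * Fz + 18 * Fqq ^ 3 * Fqy
      + 6 * Fq ^ 2 * Fqq ^ 2 * Fqqz * Fz + 3 * Fq * Fqq ^ 3 * Fqz * Fz - 2 * Fqq ^ 4 * Fz ^ 2
      + Fq * Fqq ^ 2 * Fqqq * Fz ^ 2 + 4 * Fq ^ 2 * Fqqq ^ 2 * Fz ^ 2
      - 3 * Fq ^ 2 * Fqq * Fqqqq * Fz ^ 2 - 9 * Fq ^ 2 * Fqq ^ 3 * Fzz) • o1 ⊙ₛ o1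
    + (6 * DFqqq * Fqq ^ 2 - 6 * Fqq ^ 2 * Fqqp - 8 * DFqq * Fqq * Fqqq + 8 * DFq * Fqqq ^ 2
        - 8 * Fp * Fqqq ^ 2 - 6 * DFq * Fqq * Fqqqq + 6 * Fp * Fqq * Fqqqq
        - 6 * Fq * Fqq ^ 2 * Fqqz + 6 * Fqq ^ 3 * Fqz + 2 * Fqq ^ 2 * Fqqq * Fz
        - 8 * Fq * Fqqq ^ 2 * Fz + 6 * Fq * Fqq * Fqqqq * Fz) • o1 ⊙ₛ o2
    + (10 * DFqq * Fqq ^ 3 - 10 * DFq * Fqq ^ 2 * Fqqq + 10 * Fp * Fqq ^ 2 * Fqqq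
        - 10 * Fqq ^ 4 * Fz + 10 * Fq * Fqq ^ 2 * Fqqq * Fz) • o1 ⊙ₛ o3
    + (30 * Fqq ^ 4) • o1 ⊙ₛ o4
    + (30 * DFq * Fqq ^ 3 - 30 * Fp * Fqq ^ 3 - 30 * Fq * Fqq ^ 3 * Fz) • o1 ⊙ₛ o5
    + (4 * Fqqq ^ 2 - 3 * Fqq * Fqqqq) • o2 ⊙ₛ o2
    + (-10 * Fqq ^ 2 * Fqqq) • o2 ⊙ₛ o3
    + (30 * Fqq ^ 3) • o2 ⊙ₛ o5
    + (-20 * Fqq ^ 4) • o3 ⊙ₛ o3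

/-! ### The equation `z' = F(y'')` -/

/-- The real cube root. -/
def cbrt (a : ℝ) : ℝ := SignType.sign a * |a| ^ (1 / 3 : ℝ)

theorem cbrt_pow_three (a : ℝ) : cbrt a ^ 3 = a := by
  have h : (|a| ^ (1 / 3 : ℝ)) ^ 3 = |a| := by
    rw [← Real.rpow_natCast, ← Real.rpow_mul (abs_nonneg a)]
    norm_num
  rw [cbrt, mul_pow, h]
  rcases lt_trichotomy a 0 with ha | ha | ha
  · simp [sign_neg ha, abs_of_neg ha]
    norm_num
  · simp [ha]
  · simp [sign_pos ha, abs_of_pos ha]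

section Equation

variable (F : ℝ → ℝ)

/-- The set of the points `(x, y, p, q, z)` with `q` in `I`. -/
def jetDomain (I : Set ℝ) : Set Jet := {v | v 3 ∈ I}

/-- The ambient space `J × ℝ₊ × ℝ` over `J = jetDomain I`. -/
def ambDomain (I : Set ℝ) : Set Amb := {X | proj X ∈ jetDomain I ∧ 0 < X.2.1}

/-- The metric `g_F`, given by its product with `-15 (F'')^(10/3)`. -/
def gF (v : Jet) : Jet →L[ℝ] Jet →L[ℝ] ℝ :=
  let p := v 2
  let q := v 3
  let F0 := F q
  let F1 := iteratedDeriv 1 F q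
  let F2 := iteratedDeriv 2 F q
  let F3 := iteratedDeriv 3 F q
  let F4 := iteratedDeriv 4 F q
  (-15 * cbrt F2 ^ 10)⁻¹ •
    ((30 * F2 ^ 4) • (dq ⊙ₛ dy - p • dq ⊙ₛ dx)
      + (4 * F3 ^ 2 - 3 * F2 * F4) • dz ⊙ₛ dz
      + (2 * (-5 * F2 ^ 2 * F3 - 4 * F1 * F3 ^ 2 + 3 * F1 * F2 * F4)) • dp ⊙ₛ dz
      + (2 * (15 * F2 ^ 3 + 5 * q * F2 ^ 2 * F3 - 4 * F0 * F3 ^ 2 + 4 * q * F1 * F3 ^ 2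
          + 3 * F0 * F2 * F4 - 3 * q * F1 * F2 * F4)) • dx ⊙ₛ dz
      + (-20 * F2 ^ 4 + 10 * F1 * F2 ^ 2 * F3 + 4 * F1 ^ 2 * F3 ^ 2
          - 3 * F1 ^ 2 * F2 * F4) • dp ⊙ₛ dp
      + (2 * (-15 * F1 * F2 ^ 3 + 20 * q * F2 ^ 4 + 5 * F0 * F2 ^ 2 * F3
          - 10 * q * F1 * F2 ^ 2 * F3 + 4 * F0 * F1 * F3 ^ 2 - 4 * q * F1 ^ 2 * F3 ^ 2
          - 3 * F0 * F1 * F2 * F4 + 3 * q * F1 ^ 2 * F2 * F4)) • dp ⊙ₛ dx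
      + (-30 * F0 * F2 ^ 3 + 30 * q * F1 * F2 ^ 3 - 20 * q ^ 2 * F2 ^ 4
          - 10 * q * F0 * F2 ^ 2 * F3 + 10 * q ^ 2 * F1 * F2 ^ 2 * F3 + 4 * F0 ^ 2 * F3 ^ 2
          - 8 * q * F0 * F1 * F3 ^ 2 + 4 * q ^ 2 * F1 ^ 2 * F3 ^ 2 - 3 * F0 ^ 2 * F2 * F4
          + 6 * q * F0 * F1 * F2 * F4 - 3 * q ^ 2 * F1 ^ 2 * F2 * F4) • dx ⊙ₛ dx)

/-- The function `P`. -/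
def coefP (q : ℝ) : ℝ :=
  (4 * iteratedDeriv 3 F q ^ 2 - 3 * iteratedDeriv 2 F q * iteratedDeriv 4 F q)
    / (90 * cbrt (iteratedDeriv 2 F q) ^ 10)

/-- The function `Q`. -/
def coefQ (q : ℝ) : ℝ :=
  (40 * iteratedDeriv 3 F q ^ 3
      - 45 * iteratedDeriv 2 F q * iteratedDeriv 3 F q * iteratedDeriv 4 F q
      + 9 * iteratedDeriv 2 F q ^ 2 * iteratedDeriv 5 F q)
    / (90 * iteratedDeriv 2 F q ^ 5)

/-- The function `A₅`. -/
def coefA (q : ℝ) : ℝ :=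
  (-224 * iteratedDeriv 3 F q ^ 4
      + 336 * iteratedDeriv 2 F q * iteratedDeriv 3 F q ^ 2 * iteratedDeriv 4 F q
      - 51 * iteratedDeriv 2 F q ^ 2 * iteratedDeriv 4 F q ^ 2
      - 80 * iteratedDeriv 2 F q ^ 2 * iteratedDeriv 3 F q * iteratedDeriv 5 F q
      + 10 * iteratedDeriv 2 F q ^ 3 * iteratedDeriv 6 F q)
    / (100 * cbrt (iteratedDeriv 2 F q) ^ 20)

/-- The coframe `(θ¹, …, θ⁵)` on the space of jets. -/
def coframe (v : Jet) : Fin 5 → Jet →L[ℝ] ℝ :=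
  let p := v 2
  let q := v 3
  let F0 := F q
  let F1 := iteratedDeriv 1 F q
  let F2 := iteratedDeriv 2 F q
  let F3 := iteratedDeriv 3 F q
  let F4 := iteratedDeriv 4 F q
  ![dy - p • dx,
    dz - F0 • dx - F1 • (dp - q • dx),
    (-(2 / √3) * cbrt F2) • (dp - q • dx),
    (30 * cbrt F2 ^ 10)⁻¹ •
      ((3 * F1 * F2 * F4 - 4 * F1 * F3 ^ 2 - 10 * F2 ^ 2 * F3) • (dp - q • dx)
        + (4 * F3 ^ 2 - 3 * F2 * F4) • (dz - F0 • dx) + (30 * F2 ^ 3) • dx),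
    (-(cbrt F2 ^ 2)) • dq]

/-- The coframe `(θ⁰, …, θ⁶)` on the ambient space: `θ⁰ = dt`, `θ⁶ = du`, and the pullbacks of
`θ¹, …, θ⁵`. -/
def ambCoframe (X : Amb) : Fin 7 → Amb →L[ℝ] ℝ :=
  let θ : Fin 5 → Amb →L[ℝ] ℝ := fun μ => pullback proj (fun v => coframe F v μ) X
  ![dt, θ 0, θ 1, θ 2, θ 3, θ 4, du]

/-- The ambient metric `t² g_F - 2 dt du - 2 t u (F'')^(4/3) P dq²`. -/
def gAmb (X : Amb) : Amb →L[ℝ] Amb →L[ℝ] ℝ :=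
  let q := proj X 3
  let t := X.2.1
  let u := X.2.2
  t ^ 2 • liftForm (gF F (proj X)) - (2 : ℝ) • dt ⊙ₛ du
    - (2 * t * u * cbrt (iteratedDeriv 2 F q) ^ 4 * coefP F q) • liftForm (dq ⊙ₛ dq)

/-- The matrix of the ambient metric in the coframe `(θ⁰, …, θ⁶)`. -/
def ambMatrix (X : Amb) : Matrix (Fin 7) (Fin 7) ℝ :=
  let P := coefP F (proj X 3)
  let t := X.2.1
  let u := X.2.2
  !![0, 0, 0, 0, 0, 0, -1;
     0, 0, 0, 0, 0, t ^ 2, 0;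
     0, 0, 0, 0, -t ^ 2, 0, 0;
     0, 0, 0, t ^ 2, 0, 0, 0;
     0, 0, -t ^ 2, 0, 0, 0, 0;
     0, t ^ 2, 0, 0, 0, -2 * t * u * P, 0;
     -1, 0, 0, 0, 0, 0, 0]

/-- The matrix `ω_{G₂}`. -/
def omegaG2 (v : Jet) : Matrix (Fin 7) (Fin 7) (Jet →L[ℝ] ℝ) :=
  let P := coefP F (v 3)
  let Q := coefQ F (v 3)
  let θ1 := coframe F v 0
  let θ2 := coframe F v 1
  let θ3 := coframe F v 2
  let θ4 := coframe F v 3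
  let θ5 := coframe F v 4
  let ψ := Q • θ2 + (9 / (2 * √3) * P) • θ3
  !![0, 0, 0, 0, 0, -(P • θ5), 0;
     θ1, 0, ψ, (1 / √3) • θ4, -((1 / (2 * √3)) • θ3), 0, -(P • θ5);
     θ2, 0, 0, (1 / √3) • θ5, 0, -((1 / (2 * √3)) • θ3), 0;
     θ3, 0, -((2 * √3 * P) • θ5), 0, (1 / √3) • θ5, -((1 / √3) • θ4), 0;
     θ4, 0, 0, -((2 * √3 * P) • θ5), 0, ψ, 0;
     θ5, 0, 0, 0, 0, 0, 0;
     0, θ5, -θ4, θ3, -θ2, θ1, 0]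

/-- The matrix `ω_{LC}`. -/
def omegaLC (X : Amb) : Matrix (Fin 7) (Fin 7) (Amb →L[ℝ] ℝ) :=
  let P := coefP F (proj X 3)
  let Q := coefQ F (proj X 3)
  let t := X.2.1
  let u := X.2.2
  let θ0 := ambCoframe F X 0
  let θ1 := ambCoframe F X 1
  let θ2 := ambCoframe F X 2
  let θ3 := ambCoframe F X 3
  let θ4 := ambCoframe F X 4
  let θ5 := ambCoframe F X 5
  let θ6 := ambCoframe F X 6
  let ψ := Q • θ2 + (9 / (2 * √3) * P) • θ3
  !![0, 0, 0, 0, 0, -((t * P) • θ5), 0;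
     (1 / t) • θ1 + (u / t ^ 2 * P) • θ5, (1 / t) • θ0, ψ, (1 / √3) • θ4,
       -((1 / (2 * √3)) • θ3),
       (u / t ^ 2 * P) • θ0 - (u / (3 * t) * Q) • θ5 - (1 / t * P) • θ6, -((1 / t * P) • θ5);
     (1 / t) • θ2, 0, (1 / t) • θ0, (1 / √3) • θ5, 0, -((1 / (2 * √3)) • θ3), 0;
     (1 / t) • θ3, 0, -((2 * √3 * P) • θ5), (1 / t) • θ0, (1 / √3) • θ5, -((1 / √3) • θ4), 0;
     (1 / t) • θ4, 0, 0, -((2 * √3 * P) • θ5), (1 / t) • θ0, ψ, 0;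
     (1 / t) • θ5, 0, 0, 0, 0, (1 / t) • θ0, 0;
     0, t • θ5, -(t • θ4), t • θ3, -(t • θ2), t • θ1 - (u * P) • θ5, 0]

/-- The stated torsion of `π^* ω_{G₂}`. -/
def torsionColumn (X : Amb) : Fin 7 → Amb [⋀^Fin 2]→L[ℝ] ℝ :=
  let P := coefP F (proj X 3)
  let θ := ambCoframe F X
  ![0, -wedge (θ 0) (θ 1) - P • wedge (θ 5) (θ 6), -wedge (θ 0) (θ 2), -wedge (θ 0) (θ 3),
    -wedge (θ 0) (θ 4), -wedge (θ 0) (θ 5), 0]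

/-- The matrix with the entry `a` in the positions `(1, 2)` and `(4, 5)`, and with all other
entries `0`. -/
def curvatureMatrix {A : Type*} [Zero A] (a : A) : Matrix (Fin 7) (Fin 7) A :=
  !![0, 0, 0, 0, 0, 0, 0;
     0, 0, a, 0, 0, 0, 0;
     0, 0, 0, 0, 0, 0, 0;
     0, 0, 0, 0, 0, 0, 0;
     0, 0, 0, 0, 0, a, 0;
     0, 0, 0, 0, 0, 0, 0;
     0, 0, 0, 0, 0, 0, 0]

end Equation

end G2Ambient

end

open G2Ambient

/-! Everything rests on a closed system of structure equations. Each dθ^i is a combination of the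
products θ^j ∧ θ^k with coefficients built from P and Q (`hasD1_coframe`), and dP = (Q/3) θ⁵, dQ =
-(A₅ + 9P²) θ⁵ (`hasDerivAt_coefP`, `hasDerivAt_coefQ`). Torsion, metricity and curvature thereby
become finitely many algebraic identities in P, Q, A₅, t, u and √3; fractional powers disappear on
writing F'' = c³.

In the curvature of ω_{G₂} everything cancels except the term A₅ θ²∧θ⁵ of dψ (`curvature_omegaG2`).
The resulting A₅ E θ²∧θ⁵ has no first column, and its contraction vanishes because E lives in the
rows 1 and 4 while θ²∧θ⁵ annihilates e₁ and e₄. This gives normality on J and, for the same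
curvature on M, Ricci flatness.

The two curvatures agree for a gauge-theoretic reason. Let g be t(1 - (uP/t) E₁₅) on the indices 1,
…, 5 and the identity on 0 and 6, where E₁₅ is the matrix unit. Then ω_{LC} = g⁻¹ (π^*ω_{G₂}) g +
g⁻¹ dg. Since g = 1 on Σ and g commutes with E, the connections coincide on Σ and the curvatures
everywhere. The proof below checks these facts entry by entry instead of using g.

The "only if" directions are uniqueness statements. Two metric connections with the same torsion
agree (`connection_diff_eq_zero`). For normal conformal connections this settles the middle block;
the difference S of the first rows then satisfies 3S + (tr S) η = 0, hence vanishes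
(`schouten_eq_zero`), and so(4,3) determines the rest (`so_first_column_zero`). -/

namespace G2Ambient

/-! ### Exterior calculus of differentiable 1-forms. -/

section Forms

variable {E E' : Type*} [NormedAddCommGroup E] [NormedSpace ℝ E]
  [NormedAddCommGroup E'] [NormedSpace ℝ E'] {ι : Type*} [Fintype ι]

theorem symProd_apply (α β : E →L[ℝ] ℝ) (v w : E) :
    (α ⊙ₛ β) v w = 1 / 2 * (α v * β w + β v * α w) := by
  simp [symProd]
  ring

/-- Evaluation on pairs turns the identities of 2-forms below into identities of real numbers,
within reach of `ring`. -/
theorem twoForm_ext {Ω Ω' : E [⋀^Fin 2]→L[ℝ] ℝ} (h : ∀ v w, Ω ![v, w] = Ω' ![v, w]) :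
    Ω = Ω' := by
  ext m
  have hm : m = ![m 0, m 1] := by
    ext i
    fin_cases i <;> rfl
  rw [hm]
  exact h _ _

theorem twoForm_zero_apply (m : Fin 2 → E) : (0 : E [⋀^Fin 2]→L[ℝ] ℝ) m = 0 := rfl

theorem zero_wedge (β : E →L[ℝ] ℝ) : wedge 0 β = 0 :=
  twoForm_ext fun v w => by simp [wedge_apply, twoForm_zero_apply]

theorem wedge_zero (α : E →L[ℝ] ℝ) : wedge α 0 = 0 :=
  twoForm_ext fun v w => by simp [wedge_apply, twoForm_zero_apply]

/-- The 1-form `α` is differentiable at `x`, with exterior derivative `Ω` there. -/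
def HasD1 (α : E → E →L[ℝ] ℝ) (Ω : E [⋀^Fin 2]→L[ℝ] ℝ) (x : E) : Prop :=
  DifferentiableAt ℝ α x ∧ d1 α x = Ω

theorem hasD1_of_hasFDerivAt {α : E → E →L[ℝ] ℝ} {α' : E →L[ℝ] E →L[ℝ] ℝ} {x : E}
    {Ω : E [⋀^Fin 2]→L[ℝ] ℝ} (h : HasFDerivAt α α' x)
    (hΩ : ∀ v w, α' v w - α' w v = Ω ![v, w]) : HasD1 α Ω x :=
  ⟨h.differentiableAt, twoForm_ext fun v w => by
    rw [d1_apply h.differentiableAt, h.fderiv, hΩ]⟩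

theorem HasD1.apply {α : E → E →L[ℝ] ℝ} {x : E} {Ω : E [⋀^Fin 2]→L[ℝ] ℝ} (h : HasD1 α Ω x)
    (v w : E) : fderiv ℝ α x v w - fderiv ℝ α x w v = Ω ![v, w] := by
  rw [← d1_apply h.1, h.2]

theorem HasD1.congr {α : E → E →L[ℝ] ℝ} {x : E} {Ω Ω' : E [⋀^Fin 2]→L[ℝ] ℝ} (h : HasD1 α Ω x)
    (hΩ : ∀ v w, Ω ![v, w] = Ω' ![v, w]) : HasD1 α Ω' x :=
  ⟨h.1, h.2.trans (twoForm_ext hΩ)⟩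

theorem HasD1.congr_of_eventuallyEq {α β : E → E →L[ℝ] ℝ} {x : E} {Ω : E [⋀^Fin 2]→L[ℝ] ℝ}
    (h : HasD1 α Ω x) (hβ : β =ᶠ[nhds x] α) : HasD1 β Ω x :=
  hasD1_of_hasFDerivAt (h.1.hasFDerivAt.congr_of_eventuallyEq hβ) h.apply

theorem hasD1_const (α : E →L[ℝ] ℝ) (x : E) : HasD1 (fun _ => α) 0 x :=
  hasD1_of_hasFDerivAt (hasFDerivAt_const α x) fun v w => by simp

theorem HasD1.add {α β : E → E →L[ℝ] ℝ} {x : E} {Ω Ω' : E [⋀^Fin 2]→L[ℝ] ℝ}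
    (h : HasD1 α Ω x) (h' : HasD1 β Ω' x) : HasD1 (fun y => α y + β y) (Ω + Ω') x :=
  hasD1_of_hasFDerivAt (h.1.hasFDerivAt.add h'.1.hasFDerivAt) fun v w => by
    simp [← h.apply, ← h'.apply]; ring

theorem HasD1.neg {α : E → E →L[ℝ] ℝ} {x : E} {Ω : E [⋀^Fin 2]→L[ℝ] ℝ}
    (h : HasD1 α Ω x) : HasD1 (fun y => -α y) (-Ω) x :=
  hasD1_of_hasFDerivAt (h.1.hasFDerivAt.neg) fun v w => by
    simp [← h.apply]; ring

theorem HasD1.sub {α β : E → E →L[ℝ] ℝ} {x : E} {Ω Ω' : E [⋀^Fin 2]→L[ℝ] ℝ}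
    (h : HasD1 α Ω x) (h' : HasD1 β Ω' x) : HasD1 (fun y => α y - β y) (Ω - Ω') x :=
  hasD1_of_hasFDerivAt (h.1.hasFDerivAt.sub h'.1.hasFDerivAt) fun v w => by
    simp [← h.apply, ← h'.apply]; ring

theorem HasD1.smul {f : E → ℝ} {f' : E →L[ℝ] ℝ} {α : E → E →L[ℝ] ℝ} {x : E}
    {Ω : E [⋀^Fin 2]→L[ℝ] ℝ} (hf : HasFDerivAt f f' x) (h : HasD1 α Ω x) :
    HasD1 (fun y => f y • α y) (wedge f' (α x) + f x • Ω) x :=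
  hasD1_of_hasFDerivAt (hf.fun_smul h.1.hasFDerivAt) fun v w => by
    simp [← h.apply, wedge_apply]; ring

theorem HasD1.const_smul {α : E → E →L[ℝ] ℝ} {x : E}
    {Ω : E [⋀^Fin 2]→L[ℝ] ℝ} (a : ℝ) (h : HasD1 α Ω x) :
    HasD1 (fun y => a • α y) (a • Ω) x :=
  (HasD1.smul (hasFDerivAt_const a x) h).congr fun v w => by simp [wedge_apply]

/-- The derivative of a linear `f` is constant, so the product rule leaves no second-derivative
term. -/
theorem HasD1.pullback_clm {α : E' → E' →L[ℝ] ℝ} {Ω : E' [⋀^Fin 2]→L[ℝ] ℝ} (f : E →L[ℝ] E')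
    {x : E} (h : HasD1 α Ω (f x)) :
    HasD1 (pullback f α) (Ω.compContinuousLinearMap f) x := by
  have h1 : HasFDerivAt (pullback f α) _ x :=
    ((h.1.hasFDerivAt.comp x f.hasFDerivAt).clm_comp (hasFDerivAt_const f x)).congr_of_eventuallyEq
      (.of_forall fun y => by simp [pullback])
  refine hasD1_of_hasFDerivAt h1 fun v w => ?_
  have h2 : (⇑f ∘ ![v, w] : Fin 2 → E') = ![f v, f w] := by
    ext i
    fin_cases i <;> rfl
  simp [h2, ← h.apply]

theorem curvature_eq_of_hasD1 {ω : E → Matrix ι ι (E →L[ℝ] ℝ)}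
    {Ω : Matrix ι ι (E [⋀^Fin 2]→L[ℝ] ℝ)} {x : E}
    (h : ∀ i j, HasD1 (fun y => ω y i j) (Ω i j) x) (i j : ι) :
    curvature ω x i j = Ω i j + ∑ k, wedge (ω x i k) (ω x k j) := by
  simp [curvature, (h i j).2]

/-- Curvature contains a derivative, so agreement at the point alone would not suffice. -/
theorem curvature_congr {ω ω' : E → Matrix ι ι (E →L[ℝ] ℝ)} {x : E}
    (h : ω =ᶠ[nhds x] ω') : curvature ω x = curvature ω' x := by
  ext1 i j
  have h1 : d1 (fun y => ω y i j) x = d1 (fun y => ω' y i j) x := by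
    unfold d1
    refine Filter.EventuallyEq.extDeriv_eq (h.mono fun y hy => ?_)
    simp [hy]
  simp [curvature, h1, h.self_of_nhds]

end Forms

/-! ### Dual frames, and metric connections with given torsion. -/

section Coframes

variable {E : Type*} [NormedAddCommGroup E] [NormedSpace ℝ E]
  {ι : Type*} [Fintype ι] [DecidableEq ι]

/-- A coframe without common kernel is an injection into a space of the same dimension, hence onto;
preimages of the standard basis form the dual frame. -/
theorem exists_isDualFrame [FiniteDimensional ℝ E] {θ : ι → E →L[ℝ] ℝ}
    (hd : Module.finrank ℝ E = Fintype.card ι) (h : ∀ v, (∀ i, θ i v = 0) → v = 0) :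
    ∃ e, IsDualFrame θ e ∧ ∀ v, v = ∑ i, θ i v • e i := by
  let L : E →ₗ[ℝ] (ι → ℝ) := LinearMap.pi fun i => (θ i : E →ₗ[ℝ] ℝ)
  have hL : Function.Injective L := by
    rw [injective_iff_map_eq_zero]
    exact fun v hv => h v fun i => congr_fun hv i
  have hs : Function.Surjective L :=
    (LinearMap.injective_iff_surjective_of_finrank_eq_finrank (by simp [hd])).1 hL
  choose e he using fun j : ι => hs (Pi.single j 1)
  have hde : IsDualFrame θ e := fun i j => by
    have := congr_fun (he j) i
    simpa [L, Pi.single_apply] using this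
  refine ⟨e, hde, fun v => ?_⟩
  rw [← sub_eq_zero]
  refine h _ fun i => ?_
  simp [hde i]

theorem IsDualFrame.linearIndependent {θ : ι → E →L[ℝ] ℝ} {e : ι → E} (h : IsDualFrame θ e) :
    LinearIndependent ℝ θ := by
  rw [Fintype.linearIndependent_iff]
  intro g hg i
  have := congr_arg (fun α : E →L[ℝ] ℝ => α (e i)) hg
  simpa [h _ i] using this

theorem linearIndependent_and_span_eq_top [FiniteDimensional ℝ E] {θ : ι → E →L[ℝ] ℝ}
    (hd : Module.finrank ℝ E = Fintype.card ι) (h : ∀ v, (∀ i, θ i v = 0) → v = 0) :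
    LinearIndependent ℝ θ ∧ Submodule.span ℝ (Set.range θ) = ⊤ := by
  obtain ⟨e, he, hv⟩ := exists_isDualFrame hd h
  refine ⟨he.linearIndependent, ?_⟩
  rw [eq_top_iff]
  intro α _
  have : α = ∑ i, α (e i) • θ i := by
    ext v
    conv_lhs => rw [hv v]
    simp [mul_comm]
  rw [this]
  exact Submodule.sum_mem _ fun i _ => Submodule.smul_mem _ _ (Submodule.subset_span ⟨i, rfl⟩)

/-- A metric connection is determined by its torsion. -/
theorem connection_diff_eq_zero {θ : ι → E →L[ℝ] ℝ} {e : ι → E} (he : IsDualFrame θ e)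
    (hspan : ∀ v, v = ∑ i, θ i v • e i) {G : Matrix ι ι ℝ} (hdet : G.det ≠ 0)
    {s : ι → ι → E →L[ℝ] ℝ} (ht : ∀ i, ∑ j, wedge (s i j) (θ j) = 0)
    (hG : ∀ i j, ∑ k, (G i k • s k j + G j k • s k i) = 0) (i j : ι) : s i j = 0 := by
  -- The torsion condition evaluated on `(e k, e j)`.
  have hS : ∀ i j k, s i j (e k) = s i k (e j) := fun i j k => by
    have := congr_arg (fun Ω : E [⋀^Fin 2]→L[ℝ] ℝ => Ω ![e k, e j]) (ht i)
    simp only [ContinuousAlternatingMap.sum_apply, wedge_apply, he _ _] at this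
    simp [Finset.sum_sub_distrib] at this
    linarith
  let T : ι → ι → ι → ℝ := fun i j k => ∑ m, G i m * s m j (e k)
  have hT1 : ∀ i j k, T i j k = T i k j := fun i j k => by simp only [T, hS _ j k]
  have hT2 : ∀ i j k, T i j k = -T j i k := fun i j k => by
    have := congr_arg (fun α : E →L[ℝ] ℝ => α (e k)) (hG i j)
    simp [Finset.sum_add_distrib] at this
    simp only [T]
    linarith
  -- Symmetry in the last two indices and skewness in the first two, applied alternately six times,
  -- return to `T i j k` with the opposite sign.
  have hT : ∀ i j k, T i j k = 0 := fun i j k => by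
    linarith [hT1 i j k, hT2 i k j, hT1 k i j, hT2 k j i, hT1 j k i, hT2 j i k]
  have hz : ∀ j k i, s i j (e k) = 0 := fun j k => by
    have h0 : G.mulVec (fun m => s m j (e k)) = 0 := by
      ext i
      exact hT i j k
    exact fun i => congr_fun (Matrix.eq_zero_of_mulVec_eq_zero hdet h0) i
  ext v
  rw [hspan v]
  simp [hz]

end Coframes

/-! ### Smoothness of the real cube root away from zero. -/

theorem cbrt_ne_zero {a : ℝ} (ha : a ≠ 0) : cbrt a ≠ 0 := fun h => ha <| by
  rw [← cbrt_pow_three a, h]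
  norm_num

/-- Away from zero the sign is locally constant, so the cube root is locally a real power up to
signs. -/
theorem contDiffAt_cbrt {a : ℝ} (ha : a ≠ 0) {n : WithTop ℕ∞} : ContDiffAt ℝ n cbrt a := by
  rcases lt_or_gt_of_ne ha with h | h
  · have h1 : ContDiffAt ℝ n (fun b : ℝ => -(-b) ^ (1 / 3 : ℝ)) a :=
      (contDiffAt_id.neg.rpow_const_of_ne (by simpa using ha)).neg
    refine h1.congr_of_eventuallyEq ((eventually_lt_nhds h).mono fun b hb => ?_)
    simp [cbrt, sign_neg hb, abs_of_neg hb]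
  · have h1 : ContDiffAt ℝ n (fun b : ℝ => b ^ (1 / 3 : ℝ)) a :=
      contDiffAt_id.rpow_const_of_ne ha
    refine h1.congr_of_eventuallyEq ((eventually_gt_nhds h).mono fun b hb => ?_)
    simp [cbrt, sign_pos hb, abs_of_pos hb]

theorem hasDerivAt_cbrt {a : ℝ} (ha : a ≠ 0) : HasDerivAt cbrt (1 / (3 * cbrt a ^ 2)) a := by
  have h := ((contDiffAt_cbrt ha (n := 1)).differentiableAt one_ne_zero).hasDerivAt
  have h3 : HasDerivAt (fun b => cbrt b ^ 3) 1 a := by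
    simpa [cbrt_pow_three] using hasDerivAt_id' a
  -- The cube of `cbrt` is the identity; comparing derivatives gives 3 c² c' = 1.
  have h4 := (h.fun_pow 3).unique h3
  have hc := cbrt_ne_zero ha
  refine h.congr_deriv ?_
  norm_num at h4
  rw [eq_div_iff (by positivity)]
  linarith

/-! ### Structure equations on J and the curvature of ω_{G₂}. -/

section Equation

variable {F : ℝ → ℝ} {I : Set ℝ}

theorem contDiffOn_iteratedDeriv (hI : IsOpen I) (hF : ContDiffOn ℝ (⊤ : ℕ∞) F I) (k : ℕ) :
    ContDiffOn ℝ (⊤ : ℕ∞) (iteratedDeriv k F) I := by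
  induction k with
  | zero => simpa using hF
  | succ k ih =>
    rw [iteratedDeriv_succ]
    exact ih.deriv_of_isOpen hI (by simp)

theorem hasDerivAt_iteratedDeriv (hI : IsOpen I) (hF : ContDiffOn ℝ (⊤ : ℕ∞) F I) (k : ℕ)
    {q : ℝ} (hq : q ∈ I) : HasDerivAt (iteratedDeriv k F) (iteratedDeriv (k + 1) F q) q := by
  rw [iteratedDeriv_succ]
  exact ((contDiffOn_iteratedDeriv hI hF k).contDiffAt (hI.mem_nhds hq)
    |>.differentiableAt (by simp)).hasDerivAt

theorem hasDerivAt_cbrt_iteratedDeriv (hI : IsOpen I) (hF : ContDiffOn ℝ (⊤ : ℕ∞) F I)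
    {q : ℝ} (hq : q ∈ I) (h2 : iteratedDeriv 2 F q ≠ 0) :
    HasDerivAt (fun q => cbrt (iteratedDeriv 2 F q))
      (iteratedDeriv 3 F q / (3 * cbrt (iteratedDeriv 2 F q) ^ 2)) q := by
  refine ((hasDerivAt_cbrt h2).comp q (hasDerivAt_iteratedDeriv hI hF 2 hq)).congr_deriv ?_
  ring

theorem contDiffOn_cbrt_iteratedDeriv (hI : IsOpen I) (hF : ContDiffOn ℝ (⊤ : ℕ∞) F I)
    (hF2 : ∀ q ∈ I, iteratedDeriv 2 F q ≠ 0) :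
    ContDiffOn ℝ (⊤ : ℕ∞) (fun q => cbrt (iteratedDeriv 2 F q)) I := fun q hq =>
  (contDiffAt_cbrt (hF2 q hq)).comp_contDiffWithinAt q (contDiffOn_iteratedDeriv hI hF 2 q hq)

/-- As θ⁵ = -(F'')^(2/3) dq, this says dP = (Q/3) θ⁵. -/
theorem hasDerivAt_coefP (hI : IsOpen I) (hF : ContDiffOn ℝ (⊤ : ℕ∞) F I)
    {q : ℝ} (hq : q ∈ I) (h2 : iteratedDeriv 2 F q ≠ 0) :
    HasDerivAt (coefP F) (-(cbrt (iteratedDeriv 2 F q) ^ 2 * coefQ F q / 3)) q := by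
  have d2 := hasDerivAt_iteratedDeriv hI hF 2 hq
  have d3 := hasDerivAt_iteratedDeriv hI hF 3 hq
  have d4 := hasDerivAt_iteratedDeriv hI hF 4 hq
  have dc := hasDerivAt_cbrt_iteratedDeriv hI hF hq h2
  have hc := cbrt_ne_zero h2
  have h := (((d3.fun_pow 2).const_mul 4).fun_sub ((d2.const_mul 3).fun_mul d4)).fun_div
    ((dc.fun_pow 10).const_mul 90) (by positivity)
  refine h.congr_deriv ?_
  -- With F'' replaced by c³ both sides are rational in c and the higher derivatives of F.
  have e := cbrt_pow_three (iteratedDeriv 2 F q)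
  unfold coefQ
  generalize cbrt (iteratedDeriv 2 F q) = c at e hc
  rw [← e]
  norm_num
  field_simp
  ring

/-- In terms of the coframe, dQ = -(A₅ + 9P²) θ⁵; this is the only source of A₅. -/
theorem hasDerivAt_coefQ (hI : IsOpen I) (hF : ContDiffOn ℝ (⊤ : ℕ∞) F I)
    {q : ℝ} (hq : q ∈ I) (h2 : iteratedDeriv 2 F q ≠ 0) :
    HasDerivAt (coefQ F)
      (cbrt (iteratedDeriv 2 F q) ^ 2 * (coefA F q + 9 * coefP F q ^ 2)) q := by
  have d2 := hasDerivAt_iteratedDeriv hI hF 2 hq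
  have d3 := hasDerivAt_iteratedDeriv hI hF 3 hq
  have d4 := hasDerivAt_iteratedDeriv hI hF 4 hq
  have d5 := hasDerivAt_iteratedDeriv hI hF 5 hq
  have hc := cbrt_ne_zero h2
  have h := ((((d3.fun_pow 3).const_mul 40).fun_sub
    (((d2.const_mul 45).fun_mul d3).fun_mul d4)).fun_add
      (((d2.fun_pow 2).const_mul 9).fun_mul d5)).fun_div
    ((d2.fun_pow 5).const_mul 90) (by positivity)
  refine h.congr_deriv ?_
  have e := cbrt_pow_three (iteratedDeriv 2 F q)
  unfold coefA coefP
  generalize cbrt (iteratedDeriv 2 F q) = c at e hc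
  rw [← e]
  norm_num
  field_simp
  ring

/-- A differentiable function of `q` has a multiple of `dq` as its differential. -/
theorem hasFDerivAt_comp_q {f : ℝ → ℝ} {f' : ℝ} {v : Jet} (h : HasDerivAt f f' (v 3)) :
    HasFDerivAt (fun w : Jet => f (w 3)) (f' • dq) v :=
  h.comp_hasFDerivAt v dq.hasFDerivAt

/-- Modulo θ² and θ³ the form θ⁴ is dx / c. This eliminates dx from structure equations, and it lets
dθ⁴ be computed from dP, dθ² and dθ³ instead of from the long defining formula. -/
theorem coframe_three (v : Jet) (hv : iteratedDeriv 2 F (v 3) ≠ 0) :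
    coframe F v 3 = (3 * coefP F (v 3)) • coframe F v 1
      + (√3 / 6 * (iteratedDeriv 3 F (v 3) / cbrt (iteratedDeriv 2 F (v 3)) ^ 5)) • coframe F v 2
      + (cbrt (iteratedDeriv 2 F (v 3)))⁻¹ • dx := by
  have hc := cbrt_ne_zero hv
  have e := cbrt_pow_three (iteratedDeriv 2 F (v 3))
  ext w
  simp only [coframe, coefP, Matrix.cons_val, add_apply, smul_apply,
    sub_apply, smul_eq_mul]
  generalize cbrt (iteratedDeriv 2 F (v 3)) = c at e hc
  rw [← e]
  have h3 : √3 ≠ 0 := by positivity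
  field_simp
  ring

theorem hasD1_contactForm (v : Jet) : HasD1 (fun v => dp - v 3 • dx) (-wedge dq dx) v :=
  ((hasD1_const dp v).sub (HasD1.smul dq.hasFDerivAt (hasD1_const dx v))).congr fun a b => by
    simp

/-- Here dθ¹ = -dp∧dx is a multiple of θ³∧dx; the θ²∧θ³ term compensates the summand 3P θ² of θ⁴. -/
theorem hasD1_coframe_zero (v : Jet) (hv : iteratedDeriv 2 F (v 3) ≠ 0) :
    HasD1 (fun v => coframe F v 0)
      ((3 * √3 / 2 * coefP F (v 3)) • wedge (coframe F v 1) (coframe F v 2)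
        + (√3 / 2) • wedge (coframe F v 2) (coframe F v 3)) v := by
  refine ((hasD1_const dy v).sub (HasD1.smul (dp.hasFDerivAt (x := v)) (hasD1_const dx v))).congr
    fun a b => ?_
  have hc := cbrt_ne_zero hv
  have h3 : √3 ≠ 0 := by positivity
  rw [coframe_three v hv]
  simp only [coframe, Matrix.cons_val, ContinuousAlternatingMap.add_apply,
    ContinuousAlternatingMap.sub_apply, ContinuousAlternatingMap.smul_apply,
    twoForm_zero_apply, wedge_apply, add_apply, sub_apply, smul_apply,
    smul_eq_mul]
  field_simp
  ring

/-- The terms with F' dq∧dx cancel, which leaves -F'' dq∧(dp - q dx), and F'' = c · c² splits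
between θ³ and θ⁵. -/
theorem hasD1_coframe_one (hI : IsOpen I) (hF : ContDiffOn ℝ (⊤ : ℕ∞) F I) {v : Jet}
    (hq : v 3 ∈ I) :
    HasD1 (fun v => coframe F v 1) ((√3 / 2) • wedge (coframe F v 2) (coframe F v 4)) v := by
  have d0 : HasDerivAt F (iteratedDeriv 1 F (v 3)) (v 3) := by
    simpa using hasDerivAt_iteratedDeriv hI hF 0 hq
  have d1 := hasDerivAt_iteratedDeriv hI hF 1 hq
  refine (((hasD1_const dz v).sub (HasD1.smul (hasFDerivAt_comp_q d0) (hasD1_const dx v))).sub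
    (HasD1.smul (hasFDerivAt_comp_q d1) (hasD1_contactForm v))).congr fun a b => ?_
  have e := cbrt_pow_three (iteratedDeriv 2 F (v 3))
  have h3 : √3 ≠ 0 := by positivity
  simp only [coframe, Matrix.cons_val, ContinuousAlternatingMap.add_apply,
    ContinuousAlternatingMap.sub_apply, ContinuousAlternatingMap.smul_apply,
    ContinuousAlternatingMap.neg_apply,
    twoForm_zero_apply, wedge_apply, sub_apply, smul_apply,
    smul_eq_mul, Nat.reduceAdd]
  generalize cbrt (iteratedDeriv 2 F (v 3)) = c at e
  rw [← e]
  field_simp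
  ring

theorem hasD1_coframe_two (hI : IsOpen I) (hF : ContDiffOn ℝ (⊤ : ℕ∞) F I) {v : Jet}
    (hq : v 3 ∈ I) (hv : iteratedDeriv 2 F (v 3) ≠ 0) :
    HasD1 (fun v => coframe F v 2)
      (-(2 * √3 * coefP F (v 3)) • wedge (coframe F v 1) (coframe F v 4)
        + (2 / √3) • wedge (coframe F v 3) (coframe F v 4)) v := by
  have dc := (hasDerivAt_cbrt_iteratedDeriv hI hF hq hv).const_mul (-(2 / √3))
  refine (HasD1.smul (hasFDerivAt_comp_q dc) (hasD1_contactForm v)).congr fun a b => ?_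
  have hc := cbrt_ne_zero hv
  have h3 : √3 ^ 2 = 3 := by simp
  have h3' : √3 ≠ 0 := by positivity
  rw [coframe_three v hv]
  simp only [coframe, Matrix.cons_val, ContinuousAlternatingMap.add_apply,
    ContinuousAlternatingMap.smul_apply,
    ContinuousAlternatingMap.neg_apply,
    wedge_apply, add_apply, sub_apply, smul_apply,
    smul_eq_mul]
  field_simp
  ring_nf
  simp only [h3]
  ring

theorem hasD1_coframe_four (hI : IsOpen I) (hF : ContDiffOn ℝ (⊤ : ℕ∞) F I) {v : Jet}
    (hq : v 3 ∈ I) (hv : iteratedDeriv 2 F (v 3) ≠ 0) :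
    HasD1 (fun v => coframe F v 4) 0 v := by
  have dc := ((hasDerivAt_cbrt_iteratedDeriv hI hF hq hv).fun_pow 2).fun_neg
  refine (HasD1.smul (hasFDerivAt_comp_q dc) (hasD1_const dq v)).congr fun a b => ?_
  simp [wedge_apply]
  ring

theorem hasD1_coframe_three (hI : IsOpen I) (hF : ContDiffOn ℝ (⊤ : ℕ∞) F I)
    (hF2 : ∀ q ∈ I, iteratedDeriv 2 F q ≠ 0) {v : Jet} (hq : v 3 ∈ I) :
    HasD1 (fun v => coframe F v 3)
      (-coefQ F (v 3) • wedge (coframe F v 1) (coframe F v 4)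
        - (7 * √3 / 2 * coefP F (v 3)) • wedge (coframe F v 2) (coframe F v 4)) v := by
  have hv := hF2 _ hq
  have dc := hasDerivAt_cbrt_iteratedDeriv hI hF hq hv
  have hc := cbrt_ne_zero hv
  have d3 := hasDerivAt_iteratedDeriv hI hF 3 hq
  have h1 := ((HasD1.smul (hasFDerivAt_comp_q ((hasDerivAt_coefP hI hF hq hv).const_mul 3))
    (hasD1_coframe_one hI hF hq)).add
    (HasD1.smul (hasFDerivAt_comp_q ((d3.fun_div (dc.fun_pow 5) (by positivity)).const_mul (√3 / 6)))
    (hasD1_coframe_two hI hF hq hv))).add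
    (HasD1.smul (hasFDerivAt_comp_q (dc.fun_inv hc)) (hasD1_const dx v))
  -- The expansion of θ⁴ needs F'' ≠ 0, so it can be differentiated only because it holds on a
  -- neighbourhood.
  have hU : ∀ᶠ w : Jet in nhds v, w 3 ∈ I := dq.continuous.continuousAt (hI.mem_nhds hq)
  refine (h1.congr_of_eventuallyEq (hU.mono fun w hw => coframe_three w (hF2 _ hw))).congr
    fun a b => ?_
  have e := cbrt_pow_three (iteratedDeriv 2 F (v 3))
  have h3 : √3 ^ 2 = 3 := by simp
  have h3' : √3 ≠ 0 := by positivity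
  rw [coframe_three v hv]
  simp only [coframe, coefP, Matrix.cons_val, ContinuousAlternatingMap.add_apply,
    ContinuousAlternatingMap.sub_apply, ContinuousAlternatingMap.smul_apply,
    twoForm_zero_apply, wedge_apply, add_apply, sub_apply, smul_apply,
    smul_eq_mul, Nat.reduceAdd]
  generalize cbrt (iteratedDeriv 2 F (v 3)) = c at e hc
  rw [← e]
  generalize √3 = r at h3 h3'
  norm_num
  field_simp
  ring_nf
  simp only [h3]
  ring

theorem hasFDerivAt_coefP (hI : IsOpen I) (hF : ContDiffOn ℝ (⊤ : ℕ∞) F I)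
    (hF2 : ∀ q ∈ I, iteratedDeriv 2 F q ≠ 0) {v : Jet} (hq : v 3 ∈ I) :
    HasFDerivAt (fun w : Jet => coefP F (w 3)) ((coefQ F (v 3) / 3) • coframe F v 4) v := by
  refine (hasFDerivAt_comp_q (hasDerivAt_coefP hI hF hq (hF2 _ hq))).congr_fderiv ?_
  ext w
  simp [coframe]
  ring

theorem hasFDerivAt_coefQ (hI : IsOpen I) (hF : ContDiffOn ℝ (⊤ : ℕ∞) F I)
    (hF2 : ∀ q ∈ I, iteratedDeriv 2 F q ≠ 0) {v : Jet} (hq : v 3 ∈ I) :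
    HasFDerivAt (fun w : Jet => coefQ F (w 3))
      (-(coefA F (v 3) + 9 * coefP F (v 3) ^ 2) • coframe F v 4) v := by
  refine (hasFDerivAt_comp_q (hasDerivAt_coefQ hI hF hq (hF2 _ hq))).congr_fderiv ?_
  ext w
  simp [coframe]
  ring

/-- The form `ψ`, the entry of `omegaG2` in the positions `(1, 2)` and `(4, 5)`. -/
noncomputable def formPsi (F : ℝ → ℝ) (v : Jet) : Jet →L[ℝ] ℝ :=
  coefQ F (v 3) • coframe F v 1 + (9 / (2 * √3) * coefP F (v 3)) • coframe F v 2

/-- The coefficient 9/(2√3) in ψ is what makes P dθ³ cancel the 9P² coming from dQ, and dP∧θ³ cancel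
Q dθ². -/
theorem hasD1_formPsi (hI : IsOpen I) (hF : ContDiffOn ℝ (⊤ : ℕ∞) F I)
    (hF2 : ∀ q ∈ I, iteratedDeriv 2 F q ≠ 0) {v : Jet} (hq : v 3 ∈ I) :
    HasD1 (formPsi F) (coefA F (v 3) • wedge (coframe F v 1) (coframe F v 4)
      + (3 * coefP F (v 3)) • wedge (coframe F v 3) (coframe F v 4)) v := by
  refine ((HasD1.smul (hasFDerivAt_coefQ hI hF hF2 hq) (hasD1_coframe_one hI hF hq)).add
    (HasD1.smul ((hasFDerivAt_coefP hI hF hF2 hq).const_mul (9 / (2 * √3)))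
    (hasD1_coframe_two hI hF hq (hF2 _ hq)))).congr fun a b => ?_
  have h3 : √3 ^ 2 = 3 := by simp
  have h3' : √3 ≠ 0 := by positivity
  have h3c : √3 ^ 3 = 3 * √3 := by rw [pow_succ, h3]
  simp only [ContinuousAlternatingMap.add_apply, ContinuousAlternatingMap.smul_apply,
    wedge_apply, smul_apply, smul_eq_mul]
  field_simp
  ring_nf
  simp only [h3, h3c]
  ring

/-- P and θ⁵ involve q only, so the derivative is a multiple of dq∧dq. -/
theorem hasD1_coefP_smul_coframe_four (hI : IsOpen I) (hF : ContDiffOn ℝ (⊤ : ℕ∞) F I)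
    (hF2 : ∀ q ∈ I, iteratedDeriv 2 F q ≠ 0) {v : Jet} (hq : v 3 ∈ I) :
    HasD1 (fun v => coefP F (v 3) • coframe F v 4) 0 v :=
  (HasD1.smul (hasFDerivAt_coefP hI hF hF2 hq) (hasD1_coframe_four hI hF hq (hF2 _ hq))).congr
    fun a b => by simp [wedge_apply, twoForm_zero_apply]; ring

/-- The exterior derivatives of `θ¹, …, θ⁵`. -/
noncomputable def dCoframe (F : ℝ → ℝ) (v : Jet) : Fin 5 → Jet [⋀^Fin 2]→L[ℝ] ℝ :=
  let P := coefP F (v 3)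
  let Q := coefQ F (v 3)
  let θ := coframe F v
  ![(3 * √3 / 2 * P) • wedge (θ 1) (θ 2) + (√3 / 2) • wedge (θ 2) (θ 3),
    (√3 / 2) • wedge (θ 2) (θ 4),
    -(2 * √3 * P) • wedge (θ 1) (θ 4) + (2 / √3) • wedge (θ 3) (θ 4),
    -Q • wedge (θ 1) (θ 4) - (7 * √3 / 2 * P) • wedge (θ 2) (θ 4),
    0]

theorem hasD1_coframe (hI : IsOpen I) (hF : ContDiffOn ℝ (⊤ : ℕ∞) F I)
    (hF2 : ∀ q ∈ I, iteratedDeriv 2 F q ≠ 0) {v : Jet} (hq : v 3 ∈ I) (i : Fin 5) :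
    HasD1 (fun v => coframe F v i) (dCoframe F v i) v := by
  fin_cases i
  · exact hasD1_coframe_zero v (hF2 _ hq)
  · exact hasD1_coframe_one hI hF hq
  · exact hasD1_coframe_two hI hF hq (hF2 _ hq)
  · exact hasD1_coframe_three hI hF hF2 hq
  · exact hasD1_coframe_four hI hF hq (hF2 _ hq)

/-- The exterior derivative of `omegaG2`. -/
noncomputable def dOmegaG2 (F : ℝ → ℝ) (v : Jet) :
    Matrix (Fin 7) (Fin 7) (Jet [⋀^Fin 2]→L[ℝ] ℝ) :=
  let T := dCoframe F v
  let Ψ := coefA F (v 3) • wedge (coframe F v 1) (coframe F v 4)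
      + (3 * coefP F (v 3)) • wedge (coframe F v 3) (coframe F v 4)
  !![0, 0, 0, 0, 0, 0, 0;
     T 0, 0, Ψ, (1 / √3) • T 3, -((1 / (2 * √3)) • T 2), 0, 0;
     T 1, 0, 0, 0, 0, -((1 / (2 * √3)) • T 2), 0;
     T 2, 0, 0, 0, 0, -((1 / √3) • T 3), 0;
     T 3, 0, 0, 0, 0, Ψ, 0;
     0, 0, 0, 0, 0, 0, 0;
     0, 0, -T 3, T 2, -T 1, T 0, 0]

theorem hasD1_omegaG2 (hI : IsOpen I) (hF : ContDiffOn ℝ (⊤ : ℕ∞) F I)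
    (hF2 : ∀ q ∈ I, iteratedDeriv 2 F q ≠ 0) {v : Jet} (hq : v 3 ∈ I) (i j : Fin 7) :
    HasD1 (fun v => omegaG2 F v i j) (dOmegaG2 F v i j) v := by
  have hz : HasD1 (fun _ : Jet => (0 : Jet →L[ℝ] ℝ)) 0 v := hasD1_const 0 v
  have hP := hasD1_coefP_smul_coframe_four hI hF hF2 hq
  have hP' : HasD1 (fun v => -(coefP F (v 3) • coframe F v 4)) 0 v :=
    hP.neg.congr fun _ _ => by simp
  have hP3 : HasD1 (fun v => -((2 * √3 * coefP F (v 3)) • coframe F v 4)) 0 v :=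
    ((hP.const_smul (2 * √3)).neg.congr fun _ _ => by simp [twoForm_zero_apply]).congr_of_eventuallyEq
      (.of_forall fun w => by simp [smul_smul])
  have hψ := hasD1_formPsi hI hF hF2 hq
  have h0 := hasD1_coframe hI hF hF2 hq 0
  have h1 := hasD1_coframe hI hF hF2 hq 1
  have h2 := hasD1_coframe hI hF hF2 hq 2
  have h3 := hasD1_coframe hI hF hF2 hq 3
  have h4 := hasD1_coframe hI hF hF2 hq 4
  have h4' : HasD1 (fun v => (1 / √3) • coframe F v 4) 0 v :=
    (h4.const_smul _).congr fun _ _ => by simp [dCoframe, twoForm_zero_apply]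
  fin_cases i <;> fin_cases j
  exacts [hz, hz, hz, hz, hz, hP', hz,
    h0, hz, hψ, h3.const_smul _, (h2.const_smul _).neg, hz, hP',
    h1, hz, hz, h4', hz, (h2.const_smul _).neg, hz,
    h2, hz, hP3, hz, h4', (h3.const_smul _).neg, hz,
    h3, hz, hz, hP3, hz, hψ, hz,
    h4, hz, hz, hz, hz, hz, hz,
    hz, h4, h3.neg, h2, h1.neg, h0, hz]

/-- Moves √3 into numerators, so that the curvature entries are reduced by √3² = 3 alone. -/
theorem inv_sqrt_three : (√3)⁻¹ = √3 / 3 := by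
  have h3 : √3 ^ 2 = 3 := by simp
  have h3' : √3 ≠ 0 := by positivity
  field_simp
  linarith

-- In the entries (1,2) and (4,5) the term 3P θ⁴∧θ⁵ of dψ is cancelled by ω∧ω, leaving A₅ θ²∧θ⁵. In
-- all others dω and ω∧ω cancel completely.
set_option maxHeartbeats 2000000 in
theorem curvature_omegaG2 (hI : IsOpen I) (hF : ContDiffOn ℝ (⊤ : ℕ∞) F I)
    (hF2 : ∀ q ∈ I, iteratedDeriv 2 F q ≠ 0) {v : Jet} (hq : v 3 ∈ I) :
    curvature (omegaG2 F) v =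
      curvatureMatrix (coefA F (v 3) • wedge (coframe F v 1) (coframe F v 4)) := by
  have h3 : √3 ^ 2 = 3 := by simp
  ext1 i j
  rw [curvature_eq_of_hasD1 (hasD1_omegaG2 hI hF hF2 hq), Fin.sum_univ_seven]
  refine twoForm_ext fun a b => ?_
  fin_cases i <;> fin_cases j <;>
    simp only [omegaG2, dOmegaG2, dCoframe, curvatureMatrix, Matrix.of_apply, Matrix.cons_val, Fin.reduceFinMk,
      Fin.zero_eta, Fin.isValue, Fin.mk_one,
      zero_wedge, wedge_zero, add_zero, zero_add, wedge_apply,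
      ContinuousAlternatingMap.add_apply, ContinuousAlternatingMap.sub_apply,
      ContinuousAlternatingMap.smul_apply, ContinuousAlternatingMap.neg_apply, add_apply,
      smul_apply, neg_apply, smul_eq_mul, twoForm_zero_apply, div_eq_mul_inv, inv_sqrt_three,
      mul_inv] <;>
    first | done | (ring; done) | (ring_nf; simp only [h3]; ring)
end Equation

/-! ### Uniqueness of the normal conformal connection. -/

theorem sum_fin_seven {A : Type*} [AddCommMonoid A] (f : Fin 7 → A) :
    ∑ c, f c = f 0 + ∑ μ, f (mid μ) + f 6 := by
  rw [Fin.sum_univ_castSucc, Fin.sum_univ_succ]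
  rfl

theorem tractorForm_mid_mid (μ ν : Fin 5) : tractorForm (mid μ) (mid ν) = eta μ ν := by
  fin_cases μ <;> fin_cases ν <;> rfl

theorem tractorForm_mid_zero (μ : Fin 5) : tractorForm (mid μ) 0 = 0 := by
  fin_cases μ <;> rfl

theorem tractorForm_mid_six (μ : Fin 5) : tractorForm (mid μ) 6 = 0 := by
  fin_cases μ <;> rfl

theorem det_eta_ne_zero : eta.det ≠ 0 := by
  have h : eta * eta = 1 := by
    ext i j
    fin_cases i <;> fin_cases j <;> simp [eta, Matrix.mul_apply, Fin.sum_univ_succ]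
  exact fun h0 => by simpa [h0] using congr_arg Matrix.det h

/-- The matrices of `so(4, 3)` with vanishing first column are determined by their first row and
their middle block. -/
theorem so_first_column_zero {δ : Matrix (Fin 7) (Fin 7) ℝ}
    (h : ∀ a b, ∑ c, (tractorForm a c * δ c b + tractorForm b c * δ c a) = 0)
    (h0 : δ 0 0 = 0) (hm : ∀ μ, δ (mid μ) 0 = 0) :
    (∀ b, δ 6 b = 0) ∧ δ 0 6 = 0 ∧ ∀ μ, δ (mid μ) 6 = ∑ ν, eta μ ν * δ 0 (mid ν) := by
  have e1 : δ 1 0 = 0 := hm 0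
  have e2 : δ 2 0 = 0 := hm 1
  have e3 : δ 3 0 = 0 := hm 2
  have e4 : δ 4 0 = 0 := hm 3
  have e5 : δ 5 0 = 0 := hm 4
  simp only [sum_fin_seven, Fin.sum_univ_five] at h
  have h6 : ∀ b, δ 6 b = 0 := fun b => by
    -- Row 0 of the form meets only the index 6, so this relation isolates `δ 6 b`.
    have := h 0 b
    fin_cases b <;> simp [tractorForm, mid, *] at this ⊢ <;> linarith
  refine ⟨h6, ?_, fun μ => ?_⟩
  · have := h 6 6
    simp [tractorForm, mid] at this
    linarith
  -- `eta` pairs μ with 4 - μ, so this relation isolates `δ (mid μ) 6`.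
  · have := h 6 (mid (4 - μ))
    fin_cases μ <;> simp [tractorForm, mid, eta, Fin.sum_univ_succ] at this ⊢ <;> linarith

/-- The contraction of curvatures is injective on the possible first rows. -/
theorem schouten_eq_zero {S : Fin 5 → Fin 5 → ℝ}
    (h : ∀ ν κ, 3 * S ν κ + eta ν κ * ∑ μ, ∑ ρ, eta μ ρ * S ρ μ = 0) (ν κ : Fin 5) :
    S ν κ = 0 := by
  -- Contracting with `eta` gives (3 + 5) tr S = 0; only the five antidiagonal equations enter.
  have ht : ∑ μ, ∑ ρ, eta μ ρ * S ρ μ = 0 := by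
    have h04 := h 0 4
    have h13 := h 1 3
    have h22 := h 2 2
    have h31 := h 3 1
    have h40 := h 4 0
    simp [eta, Fin.sum_univ_succ] at h04 h13 h22 h31 h40 ⊢
    linarith
  have := h ν κ
  rw [ht] at this
  linarith

variable {E : Type*} [NormedAddCommGroup E] [NormedSpace ℝ E]

/-- The normal conformal connection in a coframe is unique. -/
theorem IsNormalConformalConnectionOn.unique {U : Set E} (hU : IsOpen U)
    {g : E → E →L[ℝ] E →L[ℝ] ℝ} {θ : E → Fin 5 → E →L[ℝ] ℝ}
    {ω ω' : E → Matrix (Fin 7) (Fin 7) (E →L[ℝ] ℝ)}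
    (hθ : ∀ x ∈ U, ∃ e, IsDualFrame (θ x) e ∧ ∀ v, v = ∑ i, θ x i v • e i)
    (h : IsNormalConformalConnectionOn U g θ ω) (h' : IsNormalConformalConnectionOn U g θ ω')
    {x : E} (hx : x ∈ U) : ω x = ω' x := by
  -- The difference of the two connections is in so(4,3), and soldering and gauge make its first
  -- column vanish in the rows 0 to 5.
  have hso : ∀ y ∈ U, ∀ w, (∀ b, ω y 6 b w - ω' y 6 b w = 0) ∧ ω y 0 6 w - ω' y 0 6 w = 0 ∧
      ∀ μ, ω y (mid μ) 6 w - ω' y (mid μ) 6 w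
        = ∑ ν, eta μ ν * (ω y 0 (mid ν) w - ω' y 0 (mid ν) w) := fun y hy w => by
    refine so_first_column_zero (δ := fun a b => ω y a b w - ω' y a b w) (fun a b => ?_) ?_ ?_
    · have h1 := congr_arg (fun α : E →L[ℝ] ℝ => α w) (h.so_valued y hy a b)
      have h2 := congr_arg (fun α : E →L[ℝ] ℝ => α w) (h'.so_valued y hy a b)
      simp only [sum_apply, add_apply, smul_apply, smul_eq_mul, zero_apply] at h1 h2
      rw [← sub_eq_zero.2 (h1.trans h2.symm), ← Finset.sum_sub_distrib]
      exact Finset.sum_congr rfl fun c _ => by ring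
    · simp [h.gauge y hy, h'.gauge y hy]
    · intro μ
      simp [h.soldering y hy, h'.soldering y hy]
  have h60 : ∀ {ω}, IsNormalConformalConnectionOn U g θ ω → ∀ y ∈ U, ω y 6 0 = 0 :=
    fun {ω} h y hy => by
      have h1 := h.so_valued y hy 0 0
      ext w
      have h2 := congr_arg (fun α : E →L[ℝ] ℝ => α w) h1
      simp [tractorForm, Fin.sum_univ_succ] at h2 ⊢
      linarith
  -- The middle blocks are `eta`-skew with the same torsion, hence equal. Equality on all of `U` is
  -- needed for their exterior derivatives to agree at `x`.
  have hmid : ∀ y ∈ U, ∀ μ ν, ω y (mid μ) (mid ν) = ω' y (mid μ) (mid ν) := fun y hy μ ν => by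
    obtain ⟨e, he, hspan⟩ := hθ y hy
    rw [← sub_eq_zero]
    refine connection_diff_eq_zero he hspan det_eta_ne_zero
      (s := fun μ ν => ω y (mid μ) (mid ν) - ω' y (mid μ) (mid ν)) (fun i => ?_) (fun i j => ?_) μ ν
    · have h1 := h.torsion_free y hy i
      have h2 := h'.torsion_free y hy i
      -- As ω⁰₀ = ω⁶₀ = 0, the part Ω^μ_0 of the curvature is the torsion of the middle block.
      have h3 : ∀ {ω}, IsNormalConformalConnectionOn U g θ ω → curvature ω y (mid i) 0 =
          d1 (fun y => θ y i) y + ∑ j, wedge (ω y (mid i) (mid j)) (θ y j) := fun {ω} h => by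
        have hd : d1 (fun z => ω z (mid i) 0) y = d1 (fun z => θ z i) y := by
          unfold d1
          refine Filter.EventuallyEq.extDeriv_eq
            (Filter.eventually_of_mem (hU.mem_nhds hy) fun z hz => ?_)
          simp [h.soldering z hz]
        simp only [curvature, Matrix.of_apply, hd, sum_fin_seven, h.gauge y hy, h60 h y hy,
          h.soldering y hy]
        refine twoForm_ext fun a b => ?_
        simp [wedge_apply]
      rw [h3 h] at h1
      rw [h3 h'] at h2
      have h4 := h1.trans h2.symm
      refine twoForm_ext fun a b => ?_
      have h5 := congr_arg (fun Ω : E [⋀^Fin 2]→L[ℝ] ℝ => Ω ![a, b]) h4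
      simp only [ContinuousAlternatingMap.add_apply, ContinuousAlternatingMap.sum_apply,
        add_right_inj] at h5
      simp only [ContinuousAlternatingMap.sum_apply, twoForm_zero_apply]
      rw [← sub_eq_zero.2 h5, ← Finset.sum_sub_distrib]
      refine Finset.sum_congr rfl fun c _ => ?_
      simp only [wedge_apply, sub_apply]
      ring
    · have h1 := h.so_valued y hy (mid i) (mid j)
      have h2 := h'.so_valued y hy (mid i) (mid j)
      simp only [sum_fin_seven, tractorForm_mid_zero, tractorForm_mid_six, tractorForm_mid_mid,
        zero_smul, add_zero, zero_add] at h1 h2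
      rw [← sub_eq_zero.2 (h1.trans h2.symm), ← Finset.sum_sub_distrib]
      exact Finset.sum_congr rfl fun c _ => by module
  obtain ⟨e, he, hspan⟩ := hθ x hx
  -- Skewness ties the last row to the soldering form: ω⁶_ν = η_νκ θ^κ.
  have hσ : ∀ {ω}, IsNormalConformalConnectionOn U g θ ω → ∀ ν κ,
      ω x 6 (mid ν) (e κ) = eta ν κ := fun {ω} h ν κ => by
    have h1 := congr_arg (fun α : E →L[ℝ] ℝ => α (e κ)) (h.so_valued x hx 0 (mid ν))
    have h0 : ∀ μ, tractorForm 0 (mid μ) = 0 := fun μ => by fin_cases μ <;> rfl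
    have h2 : tractorForm 0 6 = -1 ∧ tractorForm 0 0 = 0 := ⟨rfl, rfl⟩
    simp [sum_fin_seven, tractorForm_mid_zero, tractorForm_mid_six, tractorForm_mid_mid,
      h.soldering x hx, he _ _, h0, h2] at h1
    linarith
  -- The factor 4 is 5 - 1, from contracting θ^μ∧ω⁰_ν; the two `eta` terms come from ω^μ_6∧ω⁶_ν.
  have hc : ∀ {ω}, IsNormalConformalConnectionOn U g θ ω → ∀ ν κ,
      ∑ μ, (d1 (fun y => ω y (mid μ) (mid ν)) x ![e μ, e κ]
        + ∑ ρ, wedge (ω x (mid μ) (mid ρ)) (ω x (mid ρ) (mid ν)) ![e μ, e κ])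
        + (4 * ω x 0 (mid ν) (e κ) + eta ν κ * ∑ μ, ω x (mid μ) 6 (e μ)
          - ∑ μ, eta ν μ * ω x (mid μ) 6 (e κ)) = 0 := fun {ω} h ν κ => by
    have h1 := h.normal x hx e he ν (e κ)
    simp only [curvature, Matrix.of_apply, sum_fin_seven, h.soldering x hx,
      ContinuousAlternatingMap.add_apply, ContinuousAlternatingMap.sum_apply] at h1
    rw [← h1]
    simp only [wedge_apply _ _ _ _, hσ h, he _ _, Finset.sum_add_distrib, Finset.sum_sub_distrib]
    simp [Finset.mul_sum, mul_comm]
    ring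
  have hηη : ∀ (f : Fin 5 → ℝ) ν, ∑ μ, eta ν μ * ∑ ρ, eta μ ρ * f ρ = f ν := fun f ν => by
    fin_cases ν <;> simp [eta, Fin.sum_univ_succ]
  have hd : ∀ μ ν, d1 (fun y => ω y (mid μ) (mid ν)) x = d1 (fun y => ω' y (mid μ) (mid ν)) x :=
    fun μ ν => by
      unfold d1
      refine Filter.EventuallyEq.extDeriv_eq
        (Filter.eventually_of_mem (hU.mem_nhds hx) fun z hz => ?_)
      simp [hmid z hz]
  -- The middle blocks drop out of the difference of the normality equations. The last column equals
  -- η times the first row, so its second term turns 4S into 3S.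
  have hS := schouten_eq_zero (S := fun ν κ => ω x 0 (mid ν) (e κ) - ω' x 0 (mid ν) (e κ))
    fun ν κ => by
      have h1 := hc h ν κ
      have h2 := hc h' ν κ
      simp only [hd, hmid x hx] at h1
      have h3 : ∑ μ, eta ν μ * (ω x (mid μ) 6 (e κ) - ω' x (mid μ) 6 (e κ))
          = ω x 0 (mid ν) (e κ) - ω' x 0 (mid ν) (e κ) := by
        simp only [(hso x hx _).2.2]
        exact hηη (fun ρ => ω x 0 (mid ρ) (e κ) - ω' x 0 (mid ρ) (e κ)) ν
      have h4 : ∑ μ, ∑ ρ, eta μ ρ * (ω x 0 (mid ρ) (e μ) - ω' x 0 (mid ρ) (e μ))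
          = ∑ μ, ω x (mid μ) 6 (e μ) - ∑ μ, ω' x (mid μ) 6 (e μ) := by
        rw [← Finset.sum_sub_distrib]
        exact Finset.sum_congr rfl fun μ _ => ((hso x hx _).2.2 μ).symm
      simp only [mul_sub, Finset.sum_sub_distrib] at h3
      rw [h4]
      linarith
  have h0 : ∀ ν, ω x 0 (mid ν) = ω' x 0 (mid ν) := fun ν => by
    ext w
    rw [hspan w]
    simp [fun κ => sub_eq_zero.1 (hS ν κ)]
  have hcase : ∀ a : Fin 7, a = 0 ∨ a = 6 ∨ ∃ μ, a = mid μ := by decide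
  ext a b w
  obtain ⟨h6, h06, hm6⟩ := hso x hx w
  rcases hcase a with rfl | rfl | ⟨μ, rfl⟩
  · rcases hcase b with rfl | rfl | ⟨ν, rfl⟩
    · rw [h.gauge x hx, h'.gauge x hx]
    · exact sub_eq_zero.1 h06
    · rw [h0]
  · exact sub_eq_zero.1 (h6 b)
  · rcases hcase b with rfl | rfl | ⟨ν, rfl⟩
    · rw [h.soldering x hx, h'.soldering x hx]
    · refine sub_eq_zero.1 ((hm6 μ).trans ?_)
      simp [h0]
    · rw [hmid x hx]

/-! ### The coframe and the smoothness of ω_{G₂}. -/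

section Equation

variable {F : ℝ → ℝ} {I : Set ℝ}

/-- The coframe is triangular: θ² = θ³ = θ⁴ = 0 forces dx = 0, and the other coordinates follow. -/
theorem eq_zero_of_coframe_eq_zero {v : Jet} (hv : iteratedDeriv 2 F (v 3) ≠ 0) {w : Jet}
    (h : ∀ i, coframe F v i w = 0) : w = 0 := by
  have hc := cbrt_ne_zero hv
  have h3' : √3 ≠ 0 := by positivity
  have h0 := h 0
  have h1 := h 1
  have h2 := h 2
  have h3 := h 3
  have h4 := h 4
  rw [coframe_three v hv] at h3
  simp only [add_apply, smul_apply, smul_eq_mul, h1, h2, mul_zero, zero_add, mul_eq_zero,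
    inv_eq_zero, hc, false_or] at h3
  simp [coframe, hc, h3] at h0 h1 h2 h4
  rw [h2] at h1
  simp at h1
  ext i
  fin_cases i
  exacts [h3, h0, h2, h4, h1]

theorem exists_dualFrame_coframe {v : Jet} (hv : iteratedDeriv 2 F (v 3) ≠ 0) :
    ∃ e, IsDualFrame (coframe F v) e ∧ ∀ w, w = ∑ i, coframe F v i w • e i :=
  exists_isDualFrame (by simp) fun _ => eq_zero_of_coframe_eq_zero hv

theorem isOpen_jetDomain (hI : IsOpen I) : IsOpen (jetDomain I) :=
  hI.preimage (continuous_apply 3)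

theorem contDiffOn_comp_q {f : ℝ → ℝ} (hf : ContDiffOn ℝ (⊤ : ℕ∞) f I) :
    ContDiffOn ℝ (⊤ : ℕ∞) (fun v : Jet => f (v 3)) (jetDomain I) :=
  hf.comp dq.contDiff.contDiffOn fun _ hv => hv

theorem contDiffOn_coefP (hI : IsOpen I) (hF : ContDiffOn ℝ (⊤ : ℕ∞) F I)
    (hF2 : ∀ q ∈ I, iteratedDeriv 2 F q ≠ 0) : ContDiffOn ℝ (⊤ : ℕ∞) (coefP F) I := by
  have d := contDiffOn_iteratedDeriv hI hF
  exact ((contDiffOn_const.mul ((d 3).pow 2)).sub ((contDiffOn_const.mul (d 2)).mul (d 4))).div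
    (contDiffOn_const.mul ((contDiffOn_cbrt_iteratedDeriv hI hF hF2).pow 10)) fun q hq =>
      mul_ne_zero (by norm_num) (pow_ne_zero _ (cbrt_ne_zero (hF2 q hq)))

theorem contDiffOn_coefQ (hI : IsOpen I) (hF : ContDiffOn ℝ (⊤ : ℕ∞) F I)
    (hF2 : ∀ q ∈ I, iteratedDeriv 2 F q ≠ 0) : ContDiffOn ℝ (⊤ : ℕ∞) (coefQ F) I := by
  have d := contDiffOn_iteratedDeriv hI hF
  exact (((contDiffOn_const.mul ((d 3).pow 3)).sub
    (((contDiffOn_const.mul (d 2)).mul (d 3)).mul (d 4))).add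
    ((contDiffOn_const.mul ((d 2).pow 2)).mul (d 5))).div
    (contDiffOn_const.mul ((d 2).pow 5)) fun q hq =>
      mul_ne_zero (by norm_num) (pow_ne_zero _ (hF2 q hq))

theorem contDiffOn_coframe (hI : IsOpen I) (hF : ContDiffOn ℝ (⊤ : ℕ∞) F I)
    (hF2 : ∀ q ∈ I, iteratedDeriv 2 F q ≠ 0) (i : Fin 5) :
    ContDiffOn ℝ (⊤ : ℕ∞) (fun v => coframe F v i) (jetDomain I) := by
  have d0 := contDiffOn_comp_q hF
  have d1 := contDiffOn_comp_q (contDiffOn_iteratedDeriv hI hF 1)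
  have d3 := contDiffOn_comp_q (contDiffOn_iteratedDeriv hI hF 3)
  have dc := contDiffOn_comp_q (contDiffOn_cbrt_iteratedDeriv hI hF hF2)
  have dP := contDiffOn_comp_q (contDiffOn_coefP hI hF hF2)
  have hc : ∀ v ∈ jetDomain I, cbrt (iteratedDeriv 2 F (v 3)) ≠ 0 :=
    fun v hv => cbrt_ne_zero (hF2 _ hv)
  have hp : ContDiffOn ℝ (⊤ : ℕ∞) (fun v : Jet => v 2) (jetDomain I) := dp.contDiff.contDiffOn
  have hq : ContDiffOn ℝ (⊤ : ℕ∞) (fun v : Jet => v 3) (jetDomain I) := dq.contDiff.contDiffOn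
  have k : ∀ α : Jet →L[ℝ] ℝ, ContDiffOn ℝ (⊤ : ℕ∞) (fun _ : Jet => α) (jetDomain I) :=
    fun α => contDiffOn_const
  have k' : ∀ a : ℝ, ContDiffOn ℝ (⊤ : ℕ∞) (fun _ : Jet => a) (jetDomain I) :=
    fun a => contDiffOn_const
  have h1 : ContDiffOn ℝ (⊤ : ℕ∞) (fun v => coframe F v 1) (jetDomain I) :=
    ((k dz).sub (d0.smul (k dx))).sub (d1.smul ((k dp).sub (hq.smul (k dx))))
  have h2 : ContDiffOn ℝ (⊤ : ℕ∞) (fun v => coframe F v 2) (jetDomain I) :=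
    ((k' (-(2 / √3))).mul dc).smul ((k dp).sub (hq.smul (k dx)))
  fin_cases i
  · exact (k dy).sub (hp.smul (k dx))
  · exact h1
  · exact h2
  · exact (((((k' 3).mul dP).smul h1).add
      (((k' (√3 / 6)).mul (d3.div (dc.pow 5) fun v hv => pow_ne_zero _ (hc v hv))).smul h2)).add
      ((dc.inv hc).smul (k dx))).congr fun v hv => coframe_three v (hF2 _ hv)
  · exact (dc.pow 2).neg.smul (k dq)

theorem isCoframeOn_coframe (hI : IsOpen I) (hF : ContDiffOn ℝ (⊤ : ℕ∞) F I)
    (hF2 : ∀ q ∈ I, iteratedDeriv 2 F q ≠ 0) : IsCoframeOn (jetDomain I) (coframe F) :=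
  ⟨contDiffOn_coframe hI hF hF2, fun v hv =>
    linearIndependent_and_span_eq_top (by simp) fun _ => eq_zero_of_coframe_eq_zero (hF2 _ hv)⟩

theorem contDiffOn_omegaG2 (hI : IsOpen I) (hF : ContDiffOn ℝ (⊤ : ℕ∞) F I)
    (hF2 : ∀ q ∈ I, iteratedDeriv 2 F q ≠ 0) (i j : Fin 7) :
    ContDiffOn ℝ (⊤ : ℕ∞) (fun v => omegaG2 F v i j) (jetDomain I) := by
  have hθ := contDiffOn_coframe hI hF hF2
  have h0 := hθ 0
  have h1 := hθ 1
  have h2 := hθ 2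
  have h3 := hθ 3
  have h4 := hθ 4
  have dP := contDiffOn_comp_q (contDiffOn_coefP hI hF hF2)
  have dQ := contDiffOn_comp_q (contDiffOn_coefQ hI hF hF2)
  have k : ∀ a : ℝ, ContDiffOn ℝ (⊤ : ℕ∞) (fun _ : Jet => a) (jetDomain I) :=
    fun a => contDiffOn_const
  have hz : ContDiffOn ℝ (⊤ : ℕ∞) (fun _ : Jet => (0 : Jet →L[ℝ] ℝ)) (jetDomain I) :=
    contDiffOn_const
  have hP := (dP.smul h4).neg
  have hP3 := (((k (2 * √3)).mul dP).smul h4).neg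
  have hψ := (dQ.smul h1).add (((k (9 / (2 * √3))).mul dP).smul h2)
  fin_cases i <;> fin_cases j
  exacts [hz, hz, hz, hz, hz, hP, hz,
    h0, hz, hψ, (k _).smul h3, ((k _).smul h2).neg, hz, hP,
    h1, hz, hz, (k _).smul h4, hz, ((k _).smul h2).neg, hz,
    h2, hz, hP3, hz, (k _).smul h4, ((k _).smul h3).neg, hz,
    h3, hz, hz, hP3, hz, hψ, hz,
    h4, hz, hz, hz, hz, hz, hz,
    hz, h4, h3.neg, h2, h1.neg, h0, hz]

/-! ### The conformal class of z' = F(y''), and normality of ω_{G₂}. -/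

/-- The derivative is stated as a function that again depends on q only, so that rewriting passes
through nested partial derivatives. -/
theorem pd_comp_q (f : ℝ → ℝ) (i : Fin 5) :
    pd i (fun w => f (w 3)) = fun w => if i = 3 then deriv f (w 3) else 0 := by
  ext v
  simp only [pd, lineDeriv]
  by_cases h : i = 3
  · subst h
    have : (fun t : ℝ => f ((v + t • Pi.single 3 1 : Jet) 3)) = fun t => f (v 3 + t) := by
      ext t
      simp
    simp only [if_true, this, deriv_comp_const_add, add_zero]
  · have : (fun t : ℝ => f ((v + t • Pi.single i 1 : Jet) 3)) = fun t => f (v 3) := by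
      ext t
      simp [Ne.symm h]
    simp [h]

/-- Removes every total-derivative term of the general formula. -/
theorem totalD_comp_q (G : Jet → ℝ) (f : ℝ → ℝ) : totalD G (fun w => f (w 3)) = fun _ => 0 := by
  ext v
  simp [totalD, pd_comp_q]

theorem gF_eq_coframe {v : Jet} (hv : iteratedDeriv 2 F (v 3) ≠ 0) :
    gF F v = (2 : ℝ) • coframe F v 0 ⊙ₛ coframe F v 4
      - (2 : ℝ) • coframe F v 1 ⊙ₛ coframe F v 3 + coframe F v 2 ⊙ₛ coframe F v 2 := by
  have hc := cbrt_ne_zero hv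
  have e := cbrt_pow_three (iteratedDeriv 2 F (v 3))
  have h3 : √3 ^ 2 = 3 := by simp
  have h3' : √3 ≠ 0 := by positivity
  ext a b
  simp only [gF, coframe, Matrix.cons_val, symProd_apply, add_apply, sub_apply, smul_apply,
    smul_eq_mul]
  generalize cbrt (iteratedDeriv 2 F (v 3)) = c at e hc
  rw [← e]
  generalize √3 = r at h3 h3'
  field_simp
  ring_nf
  simp only [h3]
  ring

theorem equationMetric_comp_q {v : Jet} (hv : iteratedDeriv 2 F (v 3) ≠ 0) :
    equationMetric (fun w => F (w 3)) v =
      (-15 * cbrt (iteratedDeriv 2 F (v 3)) ^ 10) • gF F v := by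
  have hc := cbrt_ne_zero hv
  have e1 : iteratedDeriv 1 F = deriv F := iteratedDeriv_one
  have e2 : iteratedDeriv 2 F = deriv (deriv F) := by rw [iteratedDeriv_succ, e1]
  have e3 : iteratedDeriv 3 F = deriv (deriv (deriv F)) := by rw [iteratedDeriv_succ, e2]
  have e4 : iteratedDeriv 4 F = deriv (deriv (deriv (deriv F))) := by rw [iteratedDeriv_succ, e3]
  -- The zero function occurs inside iterated derivatives, where it is no longer displayed as a
  -- function of q.
  have hz := totalD_comp_q (fun w => F (w 3)) (fun _ => 0)
  have hp := pd_comp_q (fun _ => 0)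
  rw [gF, smul_inv_smul₀ (by simpa using hc)]
  ext a b
  simp only [equationMetric, pd_comp_q, totalD_comp_q, hz, hp, Fin.reduceEq, if_true, if_false]
  simp only [symProd_apply, add_apply, sub_apply, smul_apply, smul_eq_mul, e1, e2, e3, e4]
  ring

/-- The nonzero entries lie in the rows 1 and 4, and θ²∧θ⁵ annihilates e₁ and e₄. -/
theorem curvature_omegaG2_contraction {v : Jet} {Ω : Jet [⋀^Fin 2]→L[ℝ] ℝ} {a : ℝ}
    (hΩ : Ω = a • wedge (coframe F v 1) (coframe F v 4)) {e : Fin 5 → Jet}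
    (he : IsDualFrame (coframe F v) e) (ν : Fin 5) (w : Jet) :
    ∑ μ, curvatureMatrix Ω (mid μ) (mid ν) ![e μ, w] = 0 := by
  have h0 := he 1 0
  have h1 := he 4 0
  have h2 := he 1 3
  have h3 := he 4 3
  simp at h0 h1 h2 h3
  fin_cases ν <;>
    simp [curvatureMatrix, mid, Fin.sum_univ_succ, hΩ, wedge_apply, twoForm_zero_apply,
      h0, h1, h2, h3]

set_option maxHeartbeats 2000000 in
theorem omegaG2_so_valued (v : Jet) (a b : Fin 7) :
    ∑ c, (tractorForm a c • omegaG2 F v c b + tractorForm b c • omegaG2 F v c a) = 0 := by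
  rw [Fin.sum_univ_seven]
  fin_cases a <;> fin_cases b <;>
    simp only [tractorForm, omegaG2, Matrix.of_apply, Matrix.cons_val, Fin.reduceFinMk,
      Fin.zero_eta, Fin.isValue, Fin.mk_one, zero_smul, smul_zero,
      add_zero, zero_add] <;>
    first | done | module

theorem isNormalConformalConnectionOn_omegaG2 (hI : IsOpen I) (hF : ContDiffOn ℝ (⊤ : ℕ∞) F I)
    (hF2 : ∀ q ∈ I, iteratedDeriv 2 F q ≠ 0) :
    IsNormalConformalConnectionOn (jetDomain I) (equationMetric (fun w => F (w 3)))
      (coframe F) (omegaG2 F) where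
  coframe := isCoframeOn_coframe hI hF hF2
  adapted := by
    have dc := contDiffOn_comp_q (contDiffOn_cbrt_iteratedDeriv hI hF hF2)
    have hc : ∀ v ∈ jetDomain I, -15 * cbrt (iteratedDeriv 2 F (v 3)) ^ 10 ≠ 0 := fun v hv =>
      mul_ne_zero (by norm_num) (pow_ne_zero _ (cbrt_ne_zero (hF2 _ hv)))
    refine ⟨fun v => (-15 * cbrt (iteratedDeriv 2 F (v 3)) ^ 10)⁻¹,
      (contDiffOn_const.mul (dc.pow 10)).inv hc, fun v hv => ⟨inv_ne_zero (hc v hv), ?_⟩⟩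
    rw [equationMetric_comp_q (hF2 _ hv), inv_smul_smul₀ (hc v hv), gF_eq_coframe (hF2 _ hv)]
    ext a b
    simp [eta, Fin.sum_univ_succ, symProd_apply]
    ring
  smooth := contDiffOn_omegaG2 hI hF hF2
  so_valued v _ a b := omegaG2_so_valued v a b
  soldering v _ μ := by fin_cases μ <;> rfl
  gauge _ _ := rfl
  torsion_free v hv μ := by
    rw [curvature_omegaG2 hI hF hF2 hv]
    fin_cases μ <;> rfl
  normal v hv e he ν w := by
    rw [curvature_omegaG2 hI hF hF2 hv]
    exact curvature_omegaG2_contraction rfl he ν w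

/-- Since `U` is open, each condition at a point, curvature included, sees only the values of the
matrix on `U`. -/
theorem IsNormalConformalConnectionOn.congr {E : Type*} [NormedAddCommGroup E] [NormedSpace ℝ E]
    {U : Set E} (hU : IsOpen U) {g : E → E →L[ℝ] E →L[ℝ] ℝ} {θ : E → Fin 5 → E →L[ℝ] ℝ}
    {ω ω' : E → Matrix (Fin 7) (Fin 7) (E →L[ℝ] ℝ)}
    (h : IsNormalConformalConnectionOn U g θ ω) (hω : ∀ x ∈ U, ω' x = ω x) :
    IsNormalConformalConnectionOn U g θ ω' := by
  have hc : ∀ x ∈ U, curvature ω' x = curvature ω x := fun x hx =>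
    curvature_congr (Filter.eventually_of_mem (hU.mem_nhds hx) hω)
  exact
    { coframe := h.coframe
      adapted := h.adapted
      smooth := fun a b => (h.smooth a b).congr fun x hx => by rw [hω x hx]
      so_valued := fun x hx => by rw [hω x hx]; exact h.so_valued x hx
      soldering := fun x hx => by rw [hω x hx]; exact h.soldering x hx
      gauge := fun x hx => by rw [hω x hx]; exact h.gauge x hx
      torsion_free := fun x hx => by rw [hc x hx]; exact h.torsion_free x hx
      normal := fun x hx => by rw [hc x hx]; exact h.normal x hx }

theorem isNormalConformalConnectionOn_iff (hI : IsOpen I) (hF : ContDiffOn ℝ (⊤ : ℕ∞) F I)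
    (hF2 : ∀ q ∈ I, iteratedDeriv 2 F q ≠ 0) (ω : Jet → Matrix (Fin 7) (Fin 7) (Jet →L[ℝ] ℝ)) :
    IsNormalConformalConnectionOn (jetDomain I) (equationMetric (fun w => F (w 3)))
      (coframe F) ω ↔ ∀ v ∈ jetDomain I, ω v = omegaG2 F v :=
  have h := isNormalConformalConnectionOn_omegaG2 hI hF hF2
  ⟨fun hω _ hv => hω.unique (isOpen_jetDomain hI)
    (fun _ hx => exists_dualFrame_coframe (hF2 _ hx)) h hv,
    fun hω => h.congr (isOpen_jetDomain hI) hω⟩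

/-! ### Structure equations on M and the curvature of ω_{LC}. -/

theorem fderiv_proj (X : Amb) : fderiv ℝ proj X = ContinuousLinearMap.fst ℝ Jet (ℝ × ℝ) :=
  (ContinuousLinearMap.fst ℝ Jet (ℝ × ℝ)).fderiv

theorem hasFDerivAt_sigma (v : Jet) :
    HasFDerivAt sigma (ContinuousLinearMap.inl ℝ Jet (ℝ × ℝ)) v :=
  (hasFDerivAt_id v).prodMk (hasFDerivAt_const ((1 : ℝ), (0 : ℝ)) v)

theorem ambCoframe_eq (X : Amb) : ambCoframe F X =
    ![dt, (coframe F X.1 0).comp (ContinuousLinearMap.fst ℝ Jet (ℝ × ℝ)),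
      (coframe F X.1 1).comp (ContinuousLinearMap.fst ℝ Jet (ℝ × ℝ)),
      (coframe F X.1 2).comp (ContinuousLinearMap.fst ℝ Jet (ℝ × ℝ)),
      (coframe F X.1 3).comp (ContinuousLinearMap.fst ℝ Jet (ℝ × ℝ)),
      (coframe F X.1 4).comp (ContinuousLinearMap.fst ℝ Jet (ℝ × ℝ)), du] := by
  simp only [ambCoframe, pullback, fderiv_proj]
  rfl

/-- The exterior derivatives of `θ⁰, …, θ⁶`. -/
noncomputable def dAmbCoframe (F : ℝ → ℝ) (X : Amb) : Fin 7 → Amb [⋀^Fin 2]→L[ℝ] ℝ :=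
  let P := coefP F (proj X 3)
  let Q := coefQ F (proj X 3)
  let θ := ambCoframe F X
  ![0, (3 * √3 / 2 * P) • wedge (θ 2) (θ 3) + (√3 / 2) • wedge (θ 3) (θ 4),
    (√3 / 2) • wedge (θ 3) (θ 5),
    -(2 * √3 * P) • wedge (θ 2) (θ 5) + (2 / √3) • wedge (θ 4) (θ 5),
    -Q • wedge (θ 2) (θ 5) - (7 * √3 / 2 * P) • wedge (θ 3) (θ 5),
    0, 0]

theorem fst_comp_pair (a b : Amb) : (Prod.fst ∘ ![a, b] : Fin 2 → Jet) = ![a.1, b.1] := by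
  ext i
  fin_cases i <;> rfl

theorem hasD1_ambCoframe (hI : IsOpen I) (hF : ContDiffOn ℝ (⊤ : ℕ∞) F I)
    (hF2 : ∀ q ∈ I, iteratedDeriv 2 F q ≠ 0) {X : Amb} (hq : X.1 3 ∈ I) (i : Fin 7) :
    HasD1 (fun X => ambCoframe F X i) (dAmbCoframe F X i) X := by
  have h := fun i => (hasD1_coframe hI hF hF2 hq i).pullback_clm
    (ContinuousLinearMap.fst ℝ Jet (ℝ × ℝ))
  fin_cases i
  · exact hasD1_const dt X
  · exact (h 0).congr fun a b => by
      simp [fst_comp_pair, dCoframe, dAmbCoframe, ambCoframe_eq, wedge_apply, proj]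
  · exact (h 1).congr fun a b => by
      simp [fst_comp_pair, dCoframe, dAmbCoframe, ambCoframe_eq, wedge_apply, proj]
  · exact (h 2).congr fun a b => by
      simp [fst_comp_pair, dCoframe, dAmbCoframe, ambCoframe_eq, wedge_apply, proj]
  · exact (h 3).congr fun a b => by
      simp [fst_comp_pair, dCoframe, dAmbCoframe, ambCoframe_eq, wedge_apply, proj]
  · exact (h 4).congr fun a b => by
      simp [dCoframe, dAmbCoframe, twoForm_zero_apply]
  · exact hasD1_const du X

theorem hasFDerivAt_coefP_proj (hI : IsOpen I) (hF : ContDiffOn ℝ (⊤ : ℕ∞) F I)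
    (hF2 : ∀ q ∈ I, iteratedDeriv 2 F q ≠ 0) {X : Amb} (hq : X.1 3 ∈ I) :
    HasFDerivAt (fun X : Amb => coefP F (proj X 3))
      ((coefQ F (proj X 3) / 3) • ambCoframe F X 5) X :=
  ((hasFDerivAt_coefP hI hF hF2 hq).comp X
    (ContinuousLinearMap.fst ℝ Jet (ℝ × ℝ)).hasFDerivAt).congr_fderiv (by
      ext a <;> simp [ambCoframe_eq, proj])

theorem hasFDerivAt_coefQ_proj (hI : IsOpen I) (hF : ContDiffOn ℝ (⊤ : ℕ∞) F I)
    (hF2 : ∀ q ∈ I, iteratedDeriv 2 F q ≠ 0) {X : Amb} (hq : X.1 3 ∈ I) :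
    HasFDerivAt (fun X : Amb => coefQ F (proj X 3))
      (-(coefA F (proj X 3) + 9 * coefP F (proj X 3) ^ 2) • ambCoframe F X 5) X :=
  ((hasFDerivAt_coefQ hI hF hF2 hq).comp X
    (ContinuousLinearMap.fst ℝ Jet (ℝ × ℝ)).hasFDerivAt).congr_fderiv (by
      ext a <;> simp [ambCoframe_eq, proj])

/-- The form `ψ` on the ambient space. -/
noncomputable def ambPsi (F : ℝ → ℝ) (X : Amb) : Amb →L[ℝ] ℝ :=
  coefQ F (proj X 3) • ambCoframe F X 2 + (9 / (2 * √3) * coefP F (proj X 3)) • ambCoframe F X 3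

theorem hasD1_ambPsi (hI : IsOpen I) (hF : ContDiffOn ℝ (⊤ : ℕ∞) F I)
    (hF2 : ∀ q ∈ I, iteratedDeriv 2 F q ≠ 0) {X : Amb} (hq : X.1 3 ∈ I) :
    HasD1 (ambPsi F) (coefA F (proj X 3) • wedge (ambCoframe F X 2) (ambCoframe F X 5)
      + (3 * coefP F (proj X 3)) • wedge (ambCoframe F X 4) (ambCoframe F X 5)) X :=
  (((hasD1_formPsi hI hF hF2 hq).pullback_clm
    (ContinuousLinearMap.fst ℝ Jet (ℝ × ℝ))).congr_of_eventuallyEq (.of_forall fun Y => by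
      ext a <;> simp [ambPsi, formPsi, pullback, proj, ambCoframe_eq, fderiv_fst])).congr fun a b => by
    simp [fst_comp_pair, ambCoframe_eq, wedge_apply, proj]

/-- The exterior derivative of `omegaLC`. -/
noncomputable def dOmegaLC (F : ℝ → ℝ) (X : Amb) :
    Matrix (Fin 7) (Fin 7) (Amb [⋀^Fin 2]→L[ℝ] ℝ) :=
  let A := coefA F (proj X 3)
  let P := coefP F (proj X 3)
  let Q := coefQ F (proj X 3)
  let t := X.2.1
  let u := X.2.2
  let θ := ambCoframe F X
  let T := dAmbCoframe F X
  let Ψ := A • wedge (θ 2) (θ 5) + (3 * P) • wedge (θ 4) (θ 5)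
  let S := fun i : Fin 7 => -((t ^ 2)⁻¹ • wedge (θ 0) (θ i)) + (1 / t) • T i
  let R := fun i : Fin 7 => wedge (θ 0) (θ i) + t • T i
  !![0, 0, 0, 0, 0, -(P • wedge (θ 0) (θ 5)), 0;
     S 1 + ((P / t ^ 2) • wedge (θ 6) (θ 5) - (2 * u * P / t ^ 3) • wedge (θ 0) (θ 5)), 0, Ψ,
       (1 / √3) • T 4, -((1 / (2 * √3)) • T 3),
       (P / t ^ 2) • wedge (θ 6) (θ 0) + (u * Q / (3 * t ^ 2)) • wedge (θ 5) (θ 0)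
         - ((Q / (3 * t)) • wedge (θ 6) (θ 5) - (u * Q / (3 * t ^ 2)) • wedge (θ 0) (θ 5))
         - (-((P / t ^ 2) • wedge (θ 0) (θ 6)) + (Q / (3 * t)) • wedge (θ 5) (θ 6)),
       (P / t ^ 2) • wedge (θ 0) (θ 5);
     S 2, 0, 0, 0, 0, -((1 / (2 * √3)) • T 3), 0;
     S 3, 0, 0, 0, 0, -((1 / √3) • T 4), 0;
     S 4, 0, 0, 0, 0, Ψ, 0;
     S 5, 0, 0, 0, 0, 0, 0;
     0, R 5, -R 4, R 3, -R 2, R 1 - P • wedge (θ 6) (θ 5), 0]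

theorem hasD1_omegaLC (hI : IsOpen I) (hF : ContDiffOn ℝ (⊤ : ℕ∞) F I)
    (hF2 : ∀ q ∈ I, iteratedDeriv 2 F q ≠ 0) {X : Amb} (hX : X ∈ ambDomain I) (i j : Fin 7) :
    HasD1 (fun X => omegaLC F X i j) (dOmegaLC F X i j) X := by
  have hq : X.1 3 ∈ I := hX.1
  have ht : X.2.1 ≠ 0 := hX.2.ne'
  have h := hasD1_ambCoframe hI hF hF2 hq
  have hP := hasFDerivAt_coefP_proj hI hF hF2 hq
  have hQ := hasFDerivAt_coefQ_proj hI hF hF2 hq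
  have dt' : HasFDerivAt (fun X : Amb => X.2.1) dt X := dt.hasFDerivAt
  have du' : HasFDerivAt (fun X : Amb => X.2.2) du X := du.hasFDerivAt
  have hdt : ambCoframe F X 0 = dt := rfl
  have hdu : ambCoframe F X 6 = du := rfl
  have dinv : HasFDerivAt (fun X : Amb => 1 / X.2.1) (-(X.2.1 ^ 2)⁻¹ • dt) X := by
    exact ((hasDerivAt_inv ht).comp_hasFDerivAt X dt').congr_of_eventuallyEq
      (f₁ := fun X : Amb => 1 / X.2.1) (.of_forall fun Y => by simp)
  have hz : HasD1 (fun _ : Amb => (0 : Amb →L[ℝ] ℝ)) 0 X := hasD1_const 0 X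
  have h5 : ∀ m, dAmbCoframe F X 5 m = 0 := fun _ => rfl
  have h6 : ∀ m, dAmbCoframe F X 6 m = 0 := fun _ => rfl
  have h0 : ∀ m, dAmbCoframe F X 0 m = 0 := fun _ => rfl
  have hS : ∀ i, HasD1 (fun X => (1 / X.2.1) • ambCoframe F X i)
      (-((X.2.1 ^ 2)⁻¹ • wedge (ambCoframe F X 0) (ambCoframe F X i))
        + (1 / X.2.1) • dAmbCoframe F X i) X := fun i =>
    (HasD1.smul dinv (h i)).congr fun a b => by simp [wedge_apply, hdt]; ring
  have hS0 : HasD1 (fun X => (1 / X.2.1) • ambCoframe F X 0) 0 X :=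
    (hS 0).congr fun a b => by simp [wedge_apply, h0, twoForm_zero_apply]; ring_nf; simp
  have hR : ∀ i, HasD1 (fun X => X.2.1 • ambCoframe F X i)
      (wedge (ambCoframe F X 0) (ambCoframe F X i) + X.2.1 • dAmbCoframe F X i) X := fun i =>
    (HasD1.smul dt' (h i)).congr fun a b => by simp [wedge_apply, hdt]
  have h05 : HasD1 (fun X => -((X.2.1 * coefP F (proj X 3)) • ambCoframe F X 5))
      (-(coefP F (proj X 3) • wedge (ambCoframe F X 0) (ambCoframe F X 5))) X :=
    (HasD1.smul (dt'.fun_mul hP) (h 5)).neg.congr fun a b => by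
      simp [wedge_apply, hdt, h5]; ring
  -- u/t² is differentiated as the product u · (1/t) · (1/t).
  have hut : HasFDerivAt (fun X : Amb => X.2.2 / X.2.1 ^ 2 * coefP F (proj X 3))
      ((coefP F (proj X 3) / X.2.1 ^ 2) • du - (2 * X.2.2 * coefP F (proj X 3) / X.2.1 ^ 3) • dt
        + (X.2.2 * coefQ F (proj X 3) / (3 * X.2.1 ^ 2)) • ambCoframe F X 5) X :=
    (((du'.fun_mul (dinv.fun_mul dinv)).fun_mul hP).congr_of_eventuallyEq (.of_forall fun Y => by
      ring)).congr_fderiv (by module)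
  have h10 : HasD1 (fun X => (1 / X.2.1) • ambCoframe F X 1
      + (X.2.2 / X.2.1 ^ 2 * coefP F (proj X 3)) • ambCoframe F X 5) (dOmegaLC F X 1 0) X :=
    ((hS 1).add (HasD1.smul hut (h 5))).congr fun a b => by
      simp [dOmegaLC, wedge_apply, hdt, hdu, h5]; ring
  -- The A₅ and P² terms lie along θ⁵ and drop out below, where this differential is wedged with θ⁵.
  have huQ : HasFDerivAt (fun X : Amb => X.2.2 / (3 * X.2.1) * coefQ F (proj X 3))
      ((coefQ F (proj X 3) / (3 * X.2.1)) • du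
        - (X.2.2 * coefQ F (proj X 3) / (3 * X.2.1 ^ 2)) • dt
        - (X.2.2 / (3 * X.2.1) * (coefA F (proj X 3) + 9 * coefP F (proj X 3) ^ 2))
          • ambCoframe F X 5) X :=
    (((du'.fun_mul (dinv.const_mul (1 / 3))).fun_mul hQ).congr_of_eventuallyEq
      (.of_forall fun Y => by ring)).congr_fderiv (by module)
  have htP : HasFDerivAt (fun X : Amb => 1 / X.2.1 * coefP F (proj X 3))
      ((coefQ F (proj X 3) / (3 * X.2.1)) • ambCoframe F X 5
        - (coefP F (proj X 3) / X.2.1 ^ 2) • dt) X :=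
    (dinv.fun_mul hP).congr_fderiv (by module)
  have h15 : HasD1 (fun X => (X.2.2 / X.2.1 ^ 2 * coefP F (proj X 3)) • ambCoframe F X 0
      - (X.2.2 / (3 * X.2.1) * coefQ F (proj X 3)) • ambCoframe F X 5
      - (1 / X.2.1 * coefP F (proj X 3)) • ambCoframe F X 6) (dOmegaLC F X 1 5) X :=
    (((HasD1.smul hut (h 0)).sub (HasD1.smul huQ (h 5))).sub (HasD1.smul htP (h 6))).congr
      fun a b => by simp [dOmegaLC, wedge_apply, hdt, hdu, h0, h5, h6]; ring
  have h16 : HasD1 (fun X => -((1 / X.2.1 * coefP F (proj X 3)) • ambCoframe F X 5))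
      ((coefP F (proj X 3) / X.2.1 ^ 2) • wedge (ambCoframe F X 0) (ambCoframe F X 5)) X :=
    (HasD1.smul htP (h 5)).neg.congr fun a b => by simp [wedge_apply, hdt, h5]; ring
  have h65 : HasD1 (fun X => X.2.1 • ambCoframe F X 1
      - (X.2.2 * coefP F (proj X 3)) • ambCoframe F X 5) (dOmegaLC F X 6 5) X :=
    ((hR 1).sub (HasD1.smul (du'.fun_mul hP) (h 5))).congr fun a b => by
      simp [dOmegaLC, wedge_apply, hdt, hdu, h5]; ring
  have hP3 : HasD1 (fun X => -((2 * √3 * coefP F (proj X 3)) • ambCoframe F X 5)) 0 X :=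
    (HasD1.smul (hP.const_mul (2 * √3)) (h 5)).neg.congr fun a b => by
      simp [wedge_apply, h5, twoForm_zero_apply]; ring
  have hψ := hasD1_ambPsi hI hF hF2 hq
  have h5' : HasD1 (fun X => (1 / √3) • ambCoframe F X 5) 0 X :=
    ((h 5).const_smul _).congr fun a b => by simp [h5, twoForm_zero_apply]
  have e1 := (h 4).const_smul (1 / √3)
  have e2 := ((h 3).const_smul (1 / (2 * √3))).neg
  fin_cases i <;> fin_cases j
  exacts [hz, hz, hz, hz, hz, h05, hz,
    h10, hS0, hψ, e1, e2, h15, h16,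
    hS 2, hz, hS0, h5', hz, e2, hz,
    hS 3, hz, hP3, hS0, h5', e1.neg, hz,
    hS 4, hz, hz, hP3, hS0, hψ, hz,
    hS 5, hz, hz, hz, hz, hS0, hz,
    hz, hR 5, (hR 4).neg, hR 3, (hR 2).neg, h65, hz]

-- All terms containing dt or du cancel, as the gauge relation between the two connections predicts.
set_option maxHeartbeats 4000000 in
theorem curvature_omegaLC (hI : IsOpen I) (hF : ContDiffOn ℝ (⊤ : ℕ∞) F I)
    (hF2 : ∀ q ∈ I, iteratedDeriv 2 F q ≠ 0) {X : Amb} (hX : X ∈ ambDomain I) :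
    curvature (omegaLC F) X =
      curvatureMatrix (coefA F (proj X 3) • wedge (ambCoframe F X 2) (ambCoframe F X 5)) := by
  have ht : X.2.1 ≠ 0 := hX.2.ne'
  have h3 : √3 ^ 2 = 3 := by simp
  ext1 i j
  rw [curvature_eq_of_hasD1 (hasD1_omegaLC hI hF hF2 hX), Fin.sum_univ_seven]
  refine twoForm_ext fun a b => ?_
  fin_cases i <;> fin_cases j <;>
    simp only [omegaLC, dOmegaLC, dAmbCoframe, curvatureMatrix, Matrix.of_apply, Matrix.cons_val, Fin.reduceFinMk,
      Fin.zero_eta, Fin.isValue, Fin.mk_one,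
      zero_wedge, wedge_zero, add_zero, zero_add, wedge_apply,
      ContinuousAlternatingMap.add_apply, ContinuousAlternatingMap.sub_apply,
      ContinuousAlternatingMap.smul_apply, ContinuousAlternatingMap.neg_apply, add_apply, sub_apply,
      smul_apply, neg_apply, smul_eq_mul, twoForm_zero_apply, div_eq_mul_inv, inv_sqrt_three,
      mul_inv] <;>
    first
    | done
    | (ring; done)
    | (field_simp; ring; done)
    | (field_simp; ring_nf; simp only [h3]; ring)

/-! ### The ambient coframe and the smoothness of ω_{LC}. -/

theorem eq_zero_of_ambCoframe_eq_zero {X : Amb} (hv : iteratedDeriv 2 F (X.1 3) ≠ 0) {w : Amb}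
    (h : ∀ i, ambCoframe F X i w = 0) : w = 0 := by
  rw [ambCoframe_eq] at h
  have h1 : w.1 = 0 := eq_zero_of_coframe_eq_zero hv fun i => by
    fin_cases i
    exacts [h 1, h 2, h 3, h 4, h 5]
  exact Prod.ext h1 (Prod.ext (h 0) (h 6))

theorem finrank_amb : Module.finrank ℝ Amb = Fintype.card (Fin 7) := by
  simp

theorem exists_dualFrame_ambCoframe {X : Amb} (hv : iteratedDeriv 2 F (X.1 3) ≠ 0) :
    ∃ e, IsDualFrame (ambCoframe F X) e ∧ ∀ w, w = ∑ i, ambCoframe F X i w • e i :=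
  exists_isDualFrame finrank_amb fun _ => eq_zero_of_ambCoframe_eq_zero hv

theorem isOpen_ambDomain (hI : IsOpen I) : IsOpen (ambDomain I) :=
  ((isOpen_jetDomain hI).preimage continuous_fst).inter
    (isOpen_lt continuous_const (continuous_fst.comp continuous_snd))

theorem contDiffOn_comp_proj {A : Type*} [NormedAddCommGroup A] [NormedSpace ℝ A] {f : Jet → A}
    (hf : ContDiffOn ℝ (⊤ : ℕ∞) f (jetDomain I)) :
    ContDiffOn ℝ (⊤ : ℕ∞) (fun X : Amb => f (proj X)) (ambDomain I) :=
  hf.comp contDiff_fst.contDiffOn fun _ hX => hX.1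

theorem contDiffOn_ambCoframe (hI : IsOpen I) (hF : ContDiffOn ℝ (⊤ : ℕ∞) F I)
    (hF2 : ∀ q ∈ I, iteratedDeriv 2 F q ≠ 0) (i : Fin 7) :
    ContDiffOn ℝ (⊤ : ℕ∞) (fun X => ambCoframe F X i) (ambDomain I) := by
  have h : ∀ i, ContDiffOn ℝ (⊤ : ℕ∞)
      (fun X : Amb => (coframe F X.1 i).comp (ContinuousLinearMap.fst ℝ Jet (ℝ × ℝ)))
      (ambDomain I) := fun i =>
    (contDiffOn_comp_proj (contDiffOn_coframe hI hF hF2 i)).clm_comp contDiffOn_const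
  simp only [ambCoframe_eq]
  fin_cases i
  exacts [contDiffOn_const, h 0, h 1, h 2, h 3, h 4, contDiffOn_const]

theorem isCoframeOn_ambCoframe (hI : IsOpen I) (hF : ContDiffOn ℝ (⊤ : ℕ∞) F I)
    (hF2 : ∀ q ∈ I, iteratedDeriv 2 F q ≠ 0) : IsCoframeOn (ambDomain I) (ambCoframe F) :=
  ⟨contDiffOn_ambCoframe hI hF hF2, fun _ hX =>
    linearIndependent_and_span_eq_top finrank_amb fun _ =>
      eq_zero_of_ambCoframe_eq_zero (hF2 _ hX.1)⟩

set_option maxHeartbeats 2000000 in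
theorem contDiffOn_omegaLC (hI : IsOpen I) (hF : ContDiffOn ℝ (⊤ : ℕ∞) F I)
    (hF2 : ∀ q ∈ I, iteratedDeriv 2 F q ≠ 0) (i j : Fin 7) :
    ContDiffOn ℝ (⊤ : ℕ∞) (fun X => omegaLC F X i j) (ambDomain I) := by
  have h := contDiffOn_ambCoframe hI hF hF2
  have dP := contDiffOn_comp_proj (contDiffOn_comp_q (contDiffOn_coefP hI hF hF2))
  have dQ := contDiffOn_comp_proj (contDiffOn_comp_q (contDiffOn_coefQ hI hF hF2))
  have dt' : ContDiffOn ℝ (⊤ : ℕ∞) (fun X : Amb => X.2.1) (ambDomain I) := dt.contDiff.contDiffOn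
  have du' : ContDiffOn ℝ (⊤ : ℕ∞) (fun X : Amb => X.2.2) (ambDomain I) := du.contDiff.contDiffOn
  have k : ∀ a : ℝ, ContDiffOn ℝ (⊤ : ℕ∞) (fun _ : Amb => a) (ambDomain I) :=
    fun a => contDiffOn_const
  have ht : ∀ X ∈ ambDomain I, X.2.1 ≠ 0 := fun X hX => hX.2.ne'
  have hz : ContDiffOn ℝ (⊤ : ℕ∞) (fun _ : Amb => (0 : Amb →L[ℝ] ℝ)) (ambDomain I) :=
    contDiffOn_const
  have dinv := (k 1).div dt' ht
  have hut := (du'.div (dt'.pow 2) fun X hX => pow_ne_zero _ (ht X hX)).mul dP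
  have huQ := (du'.div ((k 3).mul dt') fun X hX => mul_ne_zero (by norm_num) (ht X hX)).mul dQ
  have hψ := (dQ.smul (h 2)).add (((k (9 / (2 * √3))).mul dP).smul (h 3))
  have h05 := ((dt'.mul dP).smul (h 5)).neg
  have h10 := (dinv.smul (h 1)).add (hut.smul (h 5))
  have h15 := ((hut.smul (h 0)).sub (huQ.smul (h 5))).sub ((dinv.mul dP).smul (h 6))
  have h16 := ((dinv.mul dP).smul (h 5)).neg
  have h65 := (dt'.smul (h 1)).sub ((du'.mul dP).smul (h 5))
  have hP3 := (((k (2 * √3)).mul dP).smul (h 5)).neg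
  fin_cases i <;> fin_cases j
  exacts [hz, hz, hz, hz, hz, h05, hz,
    h10, dinv.smul (h 0), hψ, (k _).smul (h 4), ((k _).smul (h 3)).neg, h15, h16,
    dinv.smul (h 2), hz, dinv.smul (h 0), (k _).smul (h 5), hz, ((k _).smul (h 3)).neg, hz,
    dinv.smul (h 3), hz, hP3, dinv.smul (h 0), (k _).smul (h 5), ((k _).smul (h 4)).neg, hz,
    dinv.smul (h 4), hz, hz, hP3, dinv.smul (h 0), hψ, hz,
    dinv.smul (h 5), hz, hz, hz, hz, dinv.smul (h 0), hz,
    hz, dt'.smul (h 5), (dt'.smul (h 4)).neg, dt'.smul (h 3), (dt'.smul (h 2)).neg, h65, hz]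

/-! ### Torsion on M, and restriction to Σ. -/

theorem torsion_eq (hI : IsOpen I) (hF : ContDiffOn ℝ (⊤ : ℕ∞) F I)
    (hF2 : ∀ q ∈ I, iteratedDeriv 2 F q ≠ 0) {X : Amb} (hX : X ∈ ambDomain I)
    (ω : Amb → Matrix (Fin 7) (Fin 7) (Amb →L[ℝ] ℝ)) (i : Fin 7) :
    torsion (ambCoframe F) ω X i =
      dAmbCoframe F X i + ∑ j, wedge (ω X i j) (ambCoframe F X j) := by
  rw [torsion, (hasD1_ambCoframe hI hF hF2 hX.1 i).2]

theorem torsion_omegaLC (hI : IsOpen I) (hF : ContDiffOn ℝ (⊤ : ℕ∞) F I)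
    (hF2 : ∀ q ∈ I, iteratedDeriv 2 F q ≠ 0) {X : Amb} (hX : X ∈ ambDomain I) (i : Fin 7) :
    torsion (ambCoframe F) (omegaLC F) X i = 0 := by
  rw [torsion_eq hI hF hF2 hX]
  refine twoForm_ext fun a b => ?_
  fin_cases i <;>
    simp [omegaLC, dAmbCoframe, Fin.sum_univ_succ, wedge_apply,
      twoForm_zero_apply, div_eq_mul_inv, inv_sqrt_three] <;>
    ring

/-- The middle block cancels dθ^μ. What survives is the first column wedged with dt and the entry
(1,6) wedged with du. -/
theorem torsion_pullback_omegaG2 (hI : IsOpen I) (hF : ContDiffOn ℝ (⊤ : ℕ∞) F I)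
    (hF2 : ∀ q ∈ I, iteratedDeriv 2 F q ≠ 0) {X : Amb} (hX : X ∈ ambDomain I) (i : Fin 7) :
    torsion (ambCoframe F) (pullbackMatrix proj (omegaG2 F)) X i = torsionColumn F X i := by
  rw [torsion_eq hI hF hF2 hX]
  refine twoForm_ext fun a b => ?_
  fin_cases i <;>
    simp [pullbackMatrix, pullback, fderiv_proj, omegaG2, dAmbCoframe, torsionColumn,
      Fin.sum_univ_succ, wedge_apply, ambCoframe_eq, proj,
      twoForm_zero_apply, div_eq_mul_inv, inv_sqrt_three] <;>
    ring

set_option maxHeartbeats 2000000 in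
theorem pullbackMatrix_sigma_omegaLC (v : Jet) :
    pullbackMatrix sigma (omegaLC F) v = omegaG2 F v := by
  have h : ∀ i, (ambCoframe F (sigma v) i).comp (ContinuousLinearMap.inl ℝ Jet (ℝ × ℝ))
      = ![0, coframe F v 0, coframe F v 1, coframe F v 2, coframe F v 3, coframe F v 4, 0] i :=
    fun i => by
      ext w
      fin_cases i <;> simp [ambCoframe_eq, sigma, dt, du]
  have hp : proj (sigma v) = v := rfl
  have ht : (sigma v).2.1 = 1 := rfl
  have hu : (sigma v).2.2 = 0 := rfl
  ext1 i j
  simp only [pullbackMatrix, pullback, (hasFDerivAt_sigma v).fderiv]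
  fin_cases i <;> fin_cases j <;>
    simp only [omegaLC, omegaG2, hp, ht, hu, Matrix.of_apply, Matrix.cons_val, Fin.reduceFinMk,
      Fin.zero_eta, Fin.isValue, Fin.mk_one, ContinuousLinearMap.zero_comp,
      ContinuousLinearMap.add_comp, ContinuousLinearMap.sub_comp, ContinuousLinearMap.neg_comp,
      ContinuousLinearMap.smul_comp, h, smul_zero, one_pow, zero_div, zero_mul, zero_smul, div_one,
      one_mul, one_smul, add_zero, sub_zero]

/-! ### The ambient metric in the coframe, and metric compatibility. -/

theorem gAmb_eq {X : Amb} (hv : iteratedDeriv 2 F (X.1 3) ≠ 0) :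
    gAmb F X = ∑ i, ∑ j, ambMatrix F X i j • ambCoframe F X i ⊙ₛ ambCoframe F X j := by
  -- Hence (F'')^(4/3) dq² = (θ⁵)², which accounts for the entry (5,5).
  have e : ∀ w, coframe F X.1 4 w = -cbrt (iteratedDeriv 2 F (X.1 3)) ^ 2 * dq w := fun w => by
    simp [coframe]
  rw [gAmb, show proj X = X.1 from rfl, gF_eq_coframe hv]
  refine ContinuousLinearMap.ext fun a => ContinuousLinearMap.ext fun b => ?_
  simp [ambMatrix, ambCoframe_eq, Fin.sum_univ_succ, symProd_apply, liftForm, proj, e]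
  ring

theorem det_ambMatrix_ne_zero {X : Amb} (ht : X.2.1 ≠ 0) : (ambMatrix F X).det ≠ 0 := by
  -- The inverse matrix, with the (1,1) entry compensating the (5,5) entry of `ambMatrix`.
  have h : ambMatrix F X * !![0, 0, 0, 0, 0, 0, -1;
      0, 2 * X.2.2 * coefP F (proj X 3) / X.2.1 ^ 3, 0, 0, 0, (X.2.1 ^ 2)⁻¹, 0;
      0, 0, 0, 0, -(X.2.1 ^ 2)⁻¹, 0, 0;
      0, 0, 0, (X.2.1 ^ 2)⁻¹, 0, 0, 0;
      0, 0, -(X.2.1 ^ 2)⁻¹, 0, 0, 0, 0;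
      0, (X.2.1 ^ 2)⁻¹, 0, 0, 0, 0, 0;
      -1, 0, 0, 0, 0, 0, 0] = 1 := by
    ext i j
    fin_cases i <;> fin_cases j <;>
      simp [ambMatrix, Matrix.mul_apply, Fin.sum_univ_succ, ht]
    field_simp
    ring
  exact fun h0 => by simpa [h0] using congr_arg Matrix.det h

/-- The derivative of `ambMatrix`. -/
noncomputable def dAmbMatrix (F : ℝ → ℝ) (X : Amb) : Matrix (Fin 7) (Fin 7) (Amb →L[ℝ] ℝ) :=
  let P := coefP F (proj X 3)
  let Q := coefQ F (proj X 3)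
  let t := X.2.1
  let u := X.2.2
  let θ := ambCoframe F X
  let a := (2 * t) • θ 0
  let b := -((2 * u * P) • θ 0) - (2 * t * P) • θ 6 - (2 * t * u * Q / 3) • θ 5
  !![0, 0, 0, 0, 0, 0, 0;
     0, 0, 0, 0, 0, a, 0;
     0, 0, 0, 0, -a, 0, 0;
     0, 0, 0, a, 0, 0, 0;
     0, 0, -a, 0, 0, 0, 0;
     0, a, 0, 0, 0, b, 0;
     0, 0, 0, 0, 0, 0, 0]

theorem hasFDerivAt_ambMatrix (hI : IsOpen I) (hF : ContDiffOn ℝ (⊤ : ℕ∞) F I)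
    (hF2 : ∀ q ∈ I, iteratedDeriv 2 F q ≠ 0) {X : Amb} (hX : X ∈ ambDomain I) (i j : Fin 7) :
    HasFDerivAt (fun Y => ambMatrix F Y i j) (dAmbMatrix F X i j) X := by
  have hP := hasFDerivAt_coefP_proj hI hF hF2 hX.1
  have dt' : HasFDerivAt (fun X : Amb => X.2.1) (ambCoframe F X 0) X := dt.hasFDerivAt
  have du' : HasFDerivAt (fun X : Amb => X.2.2) (ambCoframe F X 6) X := du.hasFDerivAt
  have k : ∀ a : ℝ, HasFDerivAt (fun _ : Amb => a) (0 : Amb →L[ℝ] ℝ) X :=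
    fun a => hasFDerivAt_const a X
  have h2 : HasFDerivAt (fun X : Amb => X.2.1 ^ 2) ((2 * X.2.1) • ambCoframe F X 0) X :=
    ((dt'.fun_mul dt').congr_of_eventuallyEq (.of_forall fun Y => sq Y.2.1)).congr_fderiv
      (by module)
  have h55 : HasFDerivAt (fun X : Amb => -2 * X.2.1 * X.2.2 * coefP F (proj X 3))
      (dAmbMatrix F X 5 5) X :=
    (((dt'.const_mul (-2)).fun_mul du').fun_mul hP).congr_fderiv (by
      simp only [dAmbMatrix, Matrix.of_apply, Matrix.cons_val]
      module)
  fin_cases i <;> fin_cases j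
  exacts [k _, k _, k _, k _, k _, k _, k _,
    k _, k _, k _, k _, k _, h2, k _,
    k _, k _, k _, k _, h2.fun_neg, k _, k _,
    k _, k _, k _, h2, k _, k _, k _,
    k _, k _, h2.fun_neg, k _, k _, k _, k _,
    k _, h2, k _, k _, k _, h55, k _,
    k _, k _, k _, k _, k _, k _, k _]

set_option maxHeartbeats 4000000 in
theorem dAmbMatrix_eq {X : Amb} (ht : X.2.1 ≠ 0) (i j : Fin 7) :
    dAmbMatrix F X i j = ∑ k, (ambMatrix F X i k • omegaLC F X k j
      + ambMatrix F X j k • omegaLC F X k i) := by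
  rw [Fin.sum_univ_seven]
  refine ContinuousLinearMap.ext fun w => ?_
  fin_cases i <;> fin_cases j <;>
    simp only [dAmbMatrix, ambMatrix, omegaLC, Matrix.of_apply, Matrix.cons_val, Fin.reduceFinMk,
      Fin.zero_eta, Fin.isValue, Fin.mk_one,
      zero_smul, smul_zero, add_zero, zero_add, add_apply, sub_apply, smul_apply, neg_apply,
      zero_apply, smul_eq_mul] <;>
    first | done | (ring; done) | (field_simp; ring)

end Equation

/-- The Levi-Civita connection in a coframe is unique. -/
theorem IsLeviCivitaOn.unique {E : Type*} [NormedAddCommGroup E] [NormedSpace ℝ E]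
    {ι : Type*} [Fintype ι] [DecidableEq ι] {U : Set E} {g : E → E →L[ℝ] E →L[ℝ] ℝ}
    {θ : E → ι → E →L[ℝ] ℝ} {G : E → Matrix ι ι ℝ} {ω ω' : E → Matrix ι ι (E →L[ℝ] ℝ)}
    (hθ : ∀ x ∈ U, ∃ e, IsDualFrame (θ x) e ∧ ∀ v, v = ∑ i, θ x i v • e i)
    (h : IsLeviCivitaOn U g θ G ω) (h' : IsLeviCivitaOn U g θ G ω') {x : E} (hx : x ∈ U) :
    ω x = ω' x := by
  obtain ⟨e, he, hspan⟩ := hθ x hx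
  ext1 i j
  rw [← sub_eq_zero]
  refine connection_diff_eq_zero he hspan (h.nondegenerate x hx)
    (s := fun i j => ω x i j - ω' x i j) (fun i => ?_) (fun i j => ?_) i j
  · have h1 := (h.torsion_eq_zero x hx i).trans (h'.torsion_eq_zero x hx i).symm
    simp only [torsion, add_right_inj] at h1
    rw [← sub_eq_zero.2 h1, ← Finset.sum_sub_distrib]
    refine Finset.sum_congr rfl fun k _ => twoForm_ext fun a b => ?_
    simp only [wedge_apply, sub_apply, ContinuousAlternatingMap.sub_apply]
    ring
  · have h1 := (h.compatible x hx i j).unique (h'.compatible x hx i j)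
    rw [← sub_eq_zero.2 h1, ← Finset.sum_sub_distrib]
    exact Finset.sum_congr rfl fun k _ => by module

theorem contDiffOn_smul_fixed {E V : Type*} [NormedAddCommGroup E] [NormedSpace ℝ E]
    [NormedAddCommGroup V] [NormedSpace ℝ V] {U : Set E} {f : E → ℝ} (b : V)
    (hf : ContDiffOn ℝ (⊤ : ℕ∞) f U) : ContDiffOn ℝ (⊤ : ℕ∞) (fun x => f x • b) U :=
  hf.smul contDiffOn_const

/-! ### Ricci flatness, and comparison of the two connections. -/

section Equation

variable {F : ℝ → ℝ} {I : Set ℝ}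

theorem isLeviCivitaOn_iff (hI : IsOpen I) (hF : ContDiffOn ℝ (⊤ : ℕ∞) F I)
    (hF2 : ∀ q ∈ I, iteratedDeriv 2 F q ≠ 0) (ω : Amb → Matrix (Fin 7) (Fin 7) (Amb →L[ℝ] ℝ)) :
    IsLeviCivitaOn (ambDomain I) (gAmb F) (ambCoframe F) (ambMatrix F) ω ↔
      ∀ X ∈ ambDomain I, ω X = omegaLC F X := by
  -- Torsion and compatibility do not differentiate ω, so pointwise agreement on the domain is
  -- enough.
  have key : ∀ ω : Amb → Matrix (Fin 7) (Fin 7) (Amb →L[ℝ] ℝ),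
      (∀ X ∈ ambDomain I, ω X = omegaLC F X) →
      IsLeviCivitaOn (ambDomain I) (gAmb F) (ambCoframe F) (ambMatrix F) ω := fun ω hω =>
    { coframe := isCoframeOn_ambCoframe hI hF hF2
      metric_eq := fun X hX => gAmb_eq (hF2 _ hX.1)
      symm := fun X _ => by
        ext i j
        fin_cases i <;> fin_cases j <;> rfl
      nondegenerate := fun X hX => det_ambMatrix_ne_zero hX.2.ne'
      torsion_eq_zero := fun X hX i => by
        rw [← torsion_omegaLC hI hF hF2 hX i, torsion, torsion, hω X hX]
      compatible := fun X hX i j => by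
        rw [hω X hX, ← dAmbMatrix_eq hX.2.ne']
        exact hasFDerivAt_ambMatrix hI hF hF2 hX i j }
  exact ⟨fun h X hX => h.unique (fun Y hY => exists_dualFrame_ambCoframe (hF2 _ hY.1))
    (key _ fun _ _ => rfl) hX, key ω⟩

theorem isRicciFlatOn_gAmb (hI : IsOpen I) (hF : ContDiffOn ℝ (⊤ : ℕ∞) F I)
    (hF2 : ∀ q ∈ I, iteratedDeriv 2 F q ≠ 0) : IsRicciFlatOn (ambDomain I) (gAmb F) := by
  refine ⟨ambCoframe F, ambMatrix F, omegaLC F, contDiffOn_omegaLC hI hF hF2,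
    (isLeviCivitaOn_iff hI hF hF2 _).2 fun _ _ => rfl, fun X hX e he j w => ?_⟩
  rw [curvature_omegaLC hI hF hF2 hX]
  -- The contraction only meets θ²∧θ⁵ evaluated with e₁ or e₄ in the first slot.
  have h0 := he 2 1
  have h1 := he 5 1
  have h2 := he 2 4
  have h3 := he 5 4
  simp at h0 h1 h2 h3
  fin_cases j <;>
    simp [curvatureMatrix, Fin.sum_univ_succ, wedge_apply, twoForm_zero_apply, h0, h1, h2, h3]

theorem isAmbientMetricOn_gAmb (hI : IsOpen I) (hF : ContDiffOn ℝ (⊤ : ℕ∞) F I)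
    (hF2 : ∀ q ∈ I, iteratedDeriv 2 F q ≠ 0) :
    IsAmbientMetricOn (jetDomain I) (ambDomain I) (gF F) (gAmb F) where
  isOpen := isOpen_ambDomain hI
  subset _ hX := hX
  initial _ hv _ ht := ⟨hv, ht⟩
  expansion := by
    -- The index k stands for the power u^(k+1), so k = 0 is the term in u t; the series stops
    -- there.
    refine ⟨fun k v => if k = 0 then
      (-(2 * cbrt (iteratedDeriv 2 F (v 3)) ^ 4 * coefP F (v 3))) • dq ⊙ₛ dq else 0,
      fun k => ?_, fun k v _ a b => ?_, fun X hX => ?_⟩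
    · by_cases hk : k = 0
      · simp only [hk, if_true]
        exact contDiffOn_smul_fixed (dq ⊙ₛ dq)
          ((contDiffOn_const.mul
            ((contDiffOn_comp_q (contDiffOn_cbrt_iteratedDeriv hI hF hF2)).pow 4)).mul
            (contDiffOn_comp_q (contDiffOn_coefP hI hF hF2))).neg
      · simp only [hk, if_false]
        exact contDiffOn_const
    · by_cases hk : k = 0
      · simp [hk, symProd_apply, mul_comm]
      · simp [hk]
    · have h0 : ∀ a b, liftForm 0 a b = 0 := fun a b => by simp [liftForm]
      convert hasSum_single 0 fun k hk => ?_ using 1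
      · refine ContinuousLinearMap.ext fun a => ContinuousLinearMap.ext fun b => ?_
        simp [gAmb, liftForm, symProd_apply]
        ring
      · refine ContinuousLinearMap.ext fun a => ContinuousLinearMap.ext fun b => ?_
        simp [hk, h0]
  ricciFlat := isRicciFlatOn_gAmb hI hF hF2

theorem pullback2_sigma_torsion (hI : IsOpen I) (hF : ContDiffOn ℝ (⊤ : ℕ∞) F I)
    (hF2 : ∀ q ∈ I, iteratedDeriv 2 F q ≠ 0) {v : Jet} (hv : v ∈ jetDomain I) (i : Fin 7) :
    pullback2 sigma (fun X => torsion (ambCoframe F) (pullbackMatrix proj (omegaG2 F)) X i) v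
      = 0 := by
  have hX : sigma v ∈ ambDomain I := ⟨hv, one_pos⟩
  refine twoForm_ext fun a b => ?_
  have h2 : (⇑(ContinuousLinearMap.inl ℝ Jet (ℝ × ℝ)) ∘ ![a, b] : Fin 2 → Amb)
      = ![(a, 0, 0), (b, 0, 0)] := by
    ext i : 1
    fin_cases i <;> rfl
  rw [pullback2, torsion_pullback_omegaG2 hI hF hF2 hX, (hasFDerivAt_sigma v).fderiv,
    ContinuousAlternatingMap.compContinuousLinearMap_apply, h2]
  -- Each term of the torsion has a factor dt or du, and both vanish on vectors tangent to Σ.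
  fin_cases i <;>
    simp [torsionColumn, wedge_apply, ambCoframe_eq, dt, du, twoForm_zero_apply]

theorem torsion_pullback_omegaG2_ne_zero (hI : IsOpen I) (hF : ContDiffOn ℝ (⊤ : ℕ∞) F I)
    (hF2 : ∀ q ∈ I, iteratedDeriv 2 F q ≠ 0) {X : Amb} (hX : X ∈ ambDomain I) (μ : Fin 5) :
    torsion (ambCoframe F) (pullbackMatrix proj (omegaG2 F)) X (mid μ) ≠ 0 := by
  rw [torsion_pullback_omegaG2 hI hF hF2 hX]
  obtain ⟨e, he, -⟩ := exists_dualFrame_coframe (hF2 _ hX.1)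
  intro h
  -- On the pair (∂_t, e_μ) the torsion component takes the value -1; the term with du does not
  -- contribute.
  have h1 := congr_arg (fun Ω : Amb [⋀^Fin 2]→L[ℝ] ℝ => Ω ![(0, 1, 0), (e μ, 0, 0)]) h
  have h2 := he μ μ
  have h3 : (ContinuousLinearMap.fst ℝ Jet (ℝ × ℝ)) (e μ, 0, 0) = e μ := rfl
  fin_cases μ <;>
    simp [torsionColumn, mid, wedge_apply, ambCoframe_eq, dt, du, twoForm_zero_apply] at h1 h2 <;>
    exact one_ne_zero (h2.symm.trans h1)

theorem curvature_omegaLC_eq_pullback (hI : IsOpen I) (hF : ContDiffOn ℝ (⊤ : ℕ∞) F I)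
    (hF2 : ∀ q ∈ I, iteratedDeriv 2 F q ≠ 0) {X : Amb} (hX : X ∈ ambDomain I) (i j : Fin 7) :
    curvature (omegaLC F) X i j =
      pullback2 proj (fun v => curvature (omegaG2 F) v i j) X := by
  have h : ∀ Ω : Jet [⋀^Fin 2]→L[ℝ] ℝ,
      (curvatureMatrix Ω i j).compContinuousLinearMap (ContinuousLinearMap.fst ℝ Jet (ℝ × ℝ))
        = curvatureMatrix
          (Ω.compContinuousLinearMap (ContinuousLinearMap.fst ℝ Jet (ℝ × ℝ))) i j := fun Ω => by
    fin_cases i <;> fin_cases j <;> rfl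
  rw [pullback2, curvature_omegaLC hI hF hF2 hX, curvature_omegaG2 hI hF hF2 hX.1, fderiv_proj,
    h, ambCoframe_eq]
  congr 1
  refine twoForm_ext fun a b => ?_
  simp [fst_comp_pair, wedge_apply, proj]

end Equation

end G2Ambient

/-- For the equation `z' = F(y'')`: the normal conformal connection of its conformal class and the
Levi-Civita connection of its ambient metric, in the given coframes, and their comparison. -/
theorem mainTheorem4 (F : ℝ → ℝ) (I : Set ℝ) (hI : IsOpen I) (hF : ContDiffOn ℝ (⊤ : ℕ∞) F I)
    (hF2 : ∀ q ∈ I, iteratedDeriv 2 F q ≠ 0) :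
    -- `g_F` represents the conformal class of the equation
    (∀ v ∈ jetDomain I, equationMetric (fun w => F (w 3)) v =
      (-15 * cbrt (iteratedDeriv 2 F (v 3)) ^ 10) • gF F v) ∧
    -- `g_F = 2θ¹θ⁵ - 2θ²θ⁴ + (θ³)²`
    (∀ v ∈ jetDomain I, gF F v = (2 : ℝ) • coframe F v 0 ⊙ₛ coframe F v 4
      - (2 : ℝ) • coframe F v 1 ⊙ₛ coframe F v 3 + coframe F v 2 ⊙ₛ coframe F v 2) ∧
    -- the explicit ambient metric of `g_F`
    IsAmbientMetricOn (jetDomain I) (ambDomain I) (gF F) (gAmb F) ∧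
    -- `ω_{G₂}` is the normal conformal connection of the conformal class of the equation
    (∀ ω, IsNormalConformalConnectionOn (jetDomain I) (equationMetric (fun w => F (w 3)))
        (coframe F) ω ↔ ∀ v ∈ jetDomain I, ω v = omegaG2 F v) ∧
    -- `ω_{LC}` is the Levi-Civita connection of the ambient metric
    (∀ ω, IsLeviCivitaOn (ambDomain I) (gAmb F) (ambCoframe F) (ambMatrix F) ω ↔
        ∀ X ∈ ambDomain I, ω X = omegaLC F X) ∧
    -- on `Σ` the two connections coincide
    (∀ v ∈ jetDomain I, pullbackMatrix sigma (omegaLC F) v = omegaG2 F v) ∧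
    -- the torsion of `π^* ω_{G₂}`: its value, its vanishing along `Σ`, and its not vanishing
    (∀ X ∈ ambDomain I, ∀ i,
      torsion (ambCoframe F) (pullbackMatrix proj (omegaG2 F)) X i = torsionColumn F X i) ∧
    (∀ v ∈ jetDomain I, ∀ i,
      pullback2 sigma (fun X => torsion (ambCoframe F) (pullbackMatrix proj (omegaG2 F)) X i) v
        = 0) ∧
    (∀ X ∈ ambDomain I, ∀ μ,
      torsion (ambCoframe F) (pullbackMatrix proj (omegaG2 F)) X (mid μ) ≠ 0) ∧
    -- the ambient curvature does not depend on `t` and `u`, and `∂_t`, `∂_u` annihilate it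
    (∀ v ∈ jetDomain I, ∀ t t' u u' : ℝ, 0 < t → 0 < t' →
      curvature (omegaLC F) (v, t, u) = curvature (omegaLC F) (v, t', u')) ∧
    (∀ X ∈ ambDomain I, ∀ i j w,
      curvature (omegaLC F) X i j ![(0, 1, 0), w] = 0 ∧
      curvature (omegaLC F) X i j ![(0, 0, 1), w] = 0) ∧
    -- it is the curvature of `ω_{G₂}`
    (∀ X ∈ ambDomain I, ∀ i j, curvature (omegaLC F) X i j =
      pullback2 proj (fun v => curvature (omegaG2 F) v i j) X) ∧
    -- and both are given by `A₅ θ² ∧ θ⁵`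
    (∀ v ∈ jetDomain I, curvature (omegaG2 F) v =
      curvatureMatrix (coefA F (v 3) • wedge (coframe F v 1) (coframe F v 4))) ∧
    (∀ X ∈ ambDomain I, curvature (omegaLC F) X =
      curvatureMatrix (coefA F (proj X 3) • wedge (ambCoframe F X 2) (ambCoframe F X 5))) := by
  refine ⟨fun v hv => equationMetric_comp_q (hF2 _ hv), fun v hv => gF_eq_coframe (hF2 _ hv),
    isAmbientMetricOn_gAmb hI hF hF2, isNormalConformalConnectionOn_iff hI hF hF2,
    isLeviCivitaOn_iff hI hF hF2, fun v _ => pullbackMatrix_sigma_omegaLC v,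
    fun X hX => torsion_pullback_omegaG2 hI hF hF2 hX,
    fun v hv => pullback2_sigma_torsion hI hF hF2 hv,
    fun X hX => torsion_pullback_omegaG2_ne_zero hI hF hF2 hX,
    fun v hv t t' u u' ht ht' => ?_, fun X hX i j w => ?_,
    fun X hX => curvature_omegaLC_eq_pullback hI hF hF2 hX,
    fun v hv => curvature_omegaG2 hI hF hF2 hv, fun X hX => curvature_omegaLC hI hF hF2 hX⟩
  -- A₅ and θ²∧θ⁵ are pulled back from J, so after rewriting both sides depend on `v` only.
  · rw [curvature_omegaLC hI hF hF2 (X := (v, t, u)) ⟨hv, ht⟩,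
      curvature_omegaLC hI hF hF2 (X := (v, t', u')) ⟨hv, ht'⟩, ambCoframe_eq, ambCoframe_eq]
    rfl
  · rw [curvature_omegaLC hI hF hF2 hX]
    fin_cases i <;> fin_cases j <;>
      simp [curvatureMatrix, wedge_apply, ambCoframe_eq, twoForm_zero_apply]
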